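/- Let $d$ be a natural number, let $\mathcal{P}$ be a countable index set, let $C_p$ be an invertible real $d\times d$ matrix for each $p\in\mathcal{P}$, and write $C_p^{*}$ for its transpose and $C_p'=(C_p^{*})^{-1}$. Set $$\Lambda=\bigcup_{p\in\mathcal{P}}C_p'\mathbb{Z}^d,\qquad \mathcal{P}_\alpha=\{p\in\mathcal{P}: C_p^{*}\alpha\in\mathbb{Z}^d\}\quad(\alpha\in\Lambda).$$ Let $\hat f(\xi)=\int f(x)e^{-2\pi i x\cdot\xi}\,dx$ denote the Fourier transform, extended to $L^2(\mathbb{R}^d)$, let $T_a f(x)=f(x-a)$, and let $g_p,h_p\in L^2(\mathbb{R}^d)$ for $p\in\mathcal{P}$. A family $\{x_j\}$ in a Hilbert space $H$ is Bessel if there is $B<\infty$ with $\sum_j|\langle v,x_j\rangle|^2\le B\|v\|^2$ for all $v\in H$. If $M\subset H$ is a closed subspace, a Bessel family $\{y_j\}$ is an $M$-subspace dual to a Bessel family $\{x_j\}$ if $v=\sum_j\langle v,x_j\rangle y_j$ for all $v\in M$. The system $\{T_{C_pk}g_p: p\in\mathcal{P},k\in\mathbb{Z}^d\}$ satisfies the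 local integrability condition if $$\sum_{p\in\mathcal{P}}\sum_{k\in\mathbb{Z}^d}\int_{\operatorname{supp}\hat f}|\hat f(\xi+C_p'k)|^2\,|\det C_p|^{-1}\,|\hat g_p(\xi)|^2\,d\xi<\infty$$ for every $f\in L^2(\mathbb{R}^d)$ such that $\hat f\in L^\infty(\mathbb{R}^d)$ and $\operatorname{supp}\hat f$ is compact and bounded away from $0$. For a measurable set $E\subset\mathbb{R}^d$ let $V_E=\{f\in L^2(\mathbb{R}^d):\hat f=0\text{ a.e. outside }E\}$. **Theorem.** Suppose that $\{T_{C_pk}g_p\}$ and $\{T_{C_pk}h_p\}$ are Bessel and satisfy the local integrability condition, and let $E\subset\mathbb{R}^d$ be measurable. Then $\{T_{C_pk}h_p\}$ is a $V_E$-subspace dual to $\{T_{C_pk}g_p\}$ if and only if both of the following hold (with unconditionally convergent sums): 1. $\displaystyle\sum_{p\in\mathcal{P}}|\det C_p|^{-1}\,\overline{\hat h_p(\xi)}\,\hat g_p(\xi)=1$ for a.e. $\xi\in E$; 2. for every $\alpha\in\Lambda\setminus\{0\}$, $\displaystyle\sum_{p\in\mathcal{P}_\alpha}|\det C_p|^{-1}\,\overline{\hat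 h_p(\xi-\alpha)}\,\hat g_p(\xi)=0$ for a.e. $\xi\in E$. -/

import Mathlib

open MeasureTheory Topology
open scoped FourierTransform ENNReal Matrix

noncomputable section

namespace TranslationFrames

/-- Bessel sequences: `∑ⱼ |⟨v, xⱼ⟩|² ≤ B ‖v‖²` for all `v`, for some finite constant `B`. -/
def IsBessel {H J : Type*} [NormedAddCommGroup H] [InnerProductSpace ℂ H] (x : J → H) : Prop :=
  ∃ B : ℝ, ∀ v : H, Summable (fun j => ‖inner ℂ (x j) v‖ ^ 2) ∧
    ∑' j, ‖inner ℂ (x j) v‖ ^ 2 ≤ B * ‖v‖ ^ 2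

/-- `{yⱼ}` is an `M`-subspace dual to `{xⱼ}`: both are Bessel sequences and
`v = ∑ⱼ ⟨v, xⱼ⟩ yⱼ` for all `v ∈ M`. The inner product `⟨v, x⟩`, linear in `v`, is
`inner ℂ x v` in Mathlib. -/
def IsSubspaceDual {H J : Type*} [NormedAddCommGroup H] [InnerProductSpace ℂ H]
    (M : Submodule ℂ H) (x y : J → H) : Prop :=
  IsBessel x ∧ IsBessel y ∧ ∀ v ∈ M, HasSum (fun j => inner ℂ (x j) v • y j) v

/-- The Hilbert space `L²(ℝᵈ)`. -/
abbrev L2 (d : ℕ) : Type :=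
  Lp ℂ 2 (volume : Measure (EuclideanSpace ℝ (Fin d)))

/-- The translation operator `(T_a f)(x) = f(x - a)` on `L²(ℝᵈ)`. -/
def translateL2 {d : ℕ} (a : EuclideanSpace ℝ (Fin d)) (f : L2 d) : L2 d :=
  Lp.compMeasurePreserving (fun x => x - a) (measurePreserving_sub_right volume a) f

/-- The vector `A k`, for a real matrix `A` and `k ∈ ℤᵈ`. -/
def latticePoint {d : ℕ} (A : Matrix (Fin d) (Fin d) ℝ) (k : Fin d → ℤ) :
    EuclideanSpace ℝ (Fin d) :=
  WithLp.toLp 2 (A *ᵥ fun i => (k i : ℝ))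

/-- `C'`, the inverse of the transpose of `C`. -/
def dualMatrix {d : ℕ} (C : Matrix (Fin d) (Fin d) ℝ) : Matrix (Fin d) (Fin d) ℝ :=
  (Cᵀ)⁻¹

/-- The system `{T_{C_p k} g_p : p ∈ P, k ∈ ℤᵈ}`, indexed by the pairs `(p, k)`. -/
def translationSystem {d : ℕ} {P : Type*} (C : P → Matrix (Fin d) (Fin d) ℝ) (g : P → L2 d) :
    P × (Fin d → ℤ) → L2 d :=
  fun j => translateL2 (latticePoint (C j.1) j.2) (g j.1)

/-- `Λ = ⋃ₚ C_p' ℤᵈ`. -/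
def dualLatticeUnion {d : ℕ} {P : Type*} (C : P → Matrix (Fin d) (Fin d) ℝ) :
    Set (EuclideanSpace ℝ (Fin d)) :=
  ⋃ p, Set.range (latticePoint (dualMatrix (C p)))

/-- `P_α = {p ∈ P : C_p^* α ∈ ℤᵈ}`. -/
def indexSet {d : ℕ} {P : Type*} (C : P → Matrix (Fin d) (Fin d) ℝ)
    (α : EuclideanSpace ℝ (Fin d)) : Set P :=
  {p | ∃ k : Fin d → ℤ, (C p)ᵀ *ᵥ α.ofLp = fun i => (k i : ℝ)}

/-- The (closed) support of a function on `ℝᵈ` defined up to null sets: the complement of the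
largest open set on which the function vanishes almost everywhere. -/
def essSupport {d : ℕ} (u : EuclideanSpace ℝ (Fin d) → ℂ) : Set (EuclideanSpace ℝ (Fin d)) :=
  {ξ | ∀ U ∈ 𝓝 ξ, ¬ (∀ᵐ η, η ∈ U → u η = 0)}

/-- The class `𝒟` of all `f ∈ L²(ℝᵈ)` whose Fourier transform is essentially bounded, with
compact support bounded away from `0`. -/
def testClass (d : ℕ) : Set (L2 d) :=
  {f | MemLp (𝓕 f : L2 d) ∞ volume ∧ IsCompact (essSupport (𝓕 f : L2 d)) ∧
    (0 : EuclideanSpace ℝ (Fin d)) ∉ essSupport (𝓕 f : L2 d)}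

/-- The local integrability condition for `{T_{C_p k} g_p}`. -/
def LocallyIntegrableSystem {d : ℕ} {P : Type*} (C : P → Matrix (Fin d) (Fin d) ℝ)
    (g : P → L2 d) : Prop :=
  ∀ f ∈ testClass d,
    ∑' p, ∑' k : Fin d → ℤ, ∫⁻ ξ in essSupport (𝓕 f : L2 d),
      ‖(𝓕 f : L2 d) (ξ + latticePoint (dualMatrix (C p)) k)‖ₑ ^ 2 *
        ENNReal.ofReal (|(C p).det|⁻¹) * ‖(𝓕 (g p) : L2 d) ξ‖ₑ ^ 2 < ∞

/-- `V_E`, the space of all `f ∈ L²(ℝᵈ)` whose Fourier transform vanishes almost everywhere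
outside `E`. -/
def bandSpace {d : ℕ} (E : Set (EuclideanSpace ℝ (Fin d))) : Submodule ℂ (L2 d) where
  carrier := {f | ∀ᵐ ξ, ξ ∉ E → (𝓕 f : L2 d) ξ = 0}
  zero_mem' := by
    have h0 : (𝓕 (0 : L2 d) : L2 d) = 0 := (Lp.fourierTransformₗᵢ _ ℂ).map_zero
    simp only [Set.mem_ofPred_eq, h0]
    filter_upwards [Lp.coeFn_zero ℂ 2 (volume : Measure (EuclideanSpace ℝ (Fin d)))] with ξ h _
    exact h
  add_mem' := by
    intro a b ha hb
    simp only [Set.mem_ofPred_eq, FourierTransform.fourier_add] at *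
    filter_upwards [ha, hb, Lp.coeFn_add (𝓕 a : L2 d) (𝓕 b)] with ξ h1 h2 h3 hξ
    rw [h3, Pi.add_apply, h1 hξ, h2 hξ, add_zero]
  smul_mem' := by
    intro c a ha
    simp only [Set.mem_ofPred_eq, FourierTransform.fourier_smul] at *
    filter_upwards [ha, Lp.coeFn_smul c (𝓕 a : L2 d)] with ξ h1 h3 hξ
    rw [h3, Pi.smul_apply, h1 hξ, smul_zero]

end TranslationFrames

end

/-!
Let `S` be the mixed frame operator `f ↦ ∑ⱼ ⟨f, xⱼ⟩ yⱼ` of the two systems. Parseval's identity on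
each lattice `C_p ℤᵈ` writes `⟨S f, u⟩`, for band-limited `f` and `u`, as a sum over the
frequencies `α = C_p' k` of the integrals of `f̂(ξ) conj û(ξ - α)` against the conjugate of the
series in the duality condition at `α`; the local integrability condition makes it converge
absolutely. Under the duality conditions only the frequency `α = 0` survives, so `S` is the identity
on `V_E` by density. Conversely, replacing `f` and `u` by their translates by `-a` multiplies the
term of frequency `α` by `e^{2πi a·α}` and, if `S` is the identity on `V_E`, does not change the
total. An absolutely convergent almost periodic series that is constant in `a` has only its zeroth
Bohr coefficient, so every term with `α ≠ 0` vanishes and the term with `α = 0` is `⟨f, u⟩`;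
letting `f̂` and `û` range over indicator functions yields the conditions almost everywhere.
-/

namespace TranslationFrames

section MixedFrameOperator

variable {H J : Type*} [NormedAddCommGroup H] [InnerProductSpace ℂ H] {x y : J → H}

lemma IsBessel.memℓp_inner (hx : IsBessel x) (v : H) : Memℓp (fun j => inner ℂ (x j) v) 2 := by
  obtain ⟨B, hB⟩ := hx
  exact memℓp_gen (by simpa using (hB v).1)

/-- The analysis operator `v ↦ (⟨v, xⱼ⟩)ⱼ` of a Bessel sequence. -/
noncomputable def IsBessel.analysisOperator (hx : IsBessel x) : H →L[ℂ] lp (fun _ : J => ℂ) 2 :=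
  LinearMap.mkContinuousOfExistsBound
    { toFun v := ⟨fun j => inner ℂ (x j) v, hx.memℓp_inner v⟩
      map_add' v w := Subtype.ext <| funext fun j => inner_add_right (x j) v w
      map_smul' c v := Subtype.ext <| funext fun j => inner_smul_right (x j) v c } <| by
    obtain ⟨B, hB⟩ := hx
    refine ⟨√B, fun v => ?_⟩
    rw [← abs_norm, ← Real.sqrt_sq_eq_abs, ← abs_norm v, ← Real.sqrt_sq_eq_abs,
      ← Real.sqrt_mul' _ (sq_nonneg _)]
    refine Real.sqrt_le_sqrt ?_
    have h := lp.norm_rpow_eq_tsum (p := 2) (by norm_num)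
      (⟨fun j => inner ℂ (x j) v, IsBessel.memℓp_inner ⟨B, hB⟩ v⟩ : lp (fun _ : J => ℂ) 2)
    simp only [ENNReal.toReal_ofNat, Real.rpow_ofNat] at h
    exact h.trans_le (hB v).2

lemma IsBessel.analysisOperator_apply (hx : IsBessel x) (v : H) (j : J) :
    hx.analysisOperator v j = inner ℂ (x j) v := rfl

variable [CompleteSpace H]

/-- The mixed frame operator `v ↦ ∑ⱼ ⟨v, xⱼ⟩ yⱼ`, as the synthesis operator of `y` (the adjoint of
its analysis operator) composed with the analysis operator of `x`. -/
noncomputable def mixedFrameOperator (hx : IsBessel x) (hy : IsBessel y) : H →L[ℂ] H :=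
  hy.analysisOperator.adjoint ∘L hx.analysisOperator

lemma IsBessel.adjoint_analysisOperator_single [DecidableEq J] (hy : IsBessel y) (j : J) (c : ℂ) :
    hy.analysisOperator.adjoint (lp.single 2 j c) = c • y j :=
  ext_inner_right ℂ fun v => by
    rw [ContinuousLinearMap.adjoint_inner_left, lp.inner_single_left, hy.analysisOperator_apply,
      inner_smul_left]
    simp [mul_comm]

lemma hasSum_mixedFrameOperator (hx : IsBessel x) (hy : IsBessel y) (v : H) :
    HasSum (fun j => inner ℂ (x j) v • y j) (mixedFrameOperator hx hy v) := by
  classical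
  simpa only [mixedFrameOperator, ContinuousLinearMap.comp_apply,
    hy.adjoint_analysisOperator_single, hx.analysisOperator_apply] using
    hy.analysisOperator.adjoint.hasSum
      (lp.hasSum_single ENNReal.ofNat_ne_top (hx.analysisOperator v))

lemma hasSum_inner_mixedFrameOperator (hx : IsBessel x) (hy : IsBessel y) (u v : H) :
    HasSum (fun j => inner ℂ (x j) v * inner ℂ u (y j))
      (inner ℂ u (mixedFrameOperator hx hy v)) := by
  simpa only [innerSL_apply_apply, inner_smul_right] using
    (innerSL ℂ u).hasSum (hasSum_mixedFrameOperator hx hy v)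

lemma isSubspaceDual_iff_mixedFrameOperator (hx : IsBessel x) (hy : IsBessel y)
    (M : Submodule ℂ H) :
    IsSubspaceDual M x y ↔ ∀ v ∈ M, mixedFrameOperator hx hy v = v := by
  refine ⟨fun h v hv => (hasSum_mixedFrameOperator hx hy v).unique (h.2.2 v hv),
    fun h => ⟨hx, hy, fun v hv => ?_⟩⟩
  simpa only [h v hv] using hasSum_mixedFrameOperator hx hy v

end MixedFrameOperator

/-! ### Parseval's identity on the unit cube -/

section UnitCube

variable {ι : Type*}

/-- An integer vector as a real vector. -/
def intVec : (ι → ℤ) →+ (ι → ℝ) := (Int.castAddHom ℝ).compLeft ι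

lemma intVec_apply (k : ι → ℤ) (i : ι) : intVec k i = k i := rfl

/-- The half-open unit cube, a fundamental domain of `ℤ^ι` in `ℝ^ι`. -/
def unitCube (ι : Type*) : Set (ι → ℝ) := {x | ∀ i, x i ∈ Set.Ioc (0 : ℝ) 1}

/-- The representative in the unit cube of a point of the torus `ℝ^ι / ℤ^ι`. -/
noncomputable def unitCubeRep (t : UnitAddTorus ι) : ι → ℝ := fun i => AddCircle.equivIoc 1 0 (t i)

lemma coe_unitCubeRep (t : UnitAddTorus ι) (i : ι) : (unitCubeRep t i : UnitAddCircle) = t i :=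
  (AddCircle.equivIoc 1 0).symm_apply_apply (t i)

lemma measurableSet_unitCube [Countable ι] : MeasurableSet (unitCube ι) :=
  MeasurableSet.univ_pi' fun _ => measurableSet_Ioc

lemma isBounded_unitCube : Bornology.IsBounded (unitCube ι) :=
  (Bornology.IsBounded.pi fun _ => Metric.isBounded_Ioc (0 : ℝ) 1).subset fun _ hx i _ => hx i

variable [Fintype ι]

/-- The character `x ↦ exp (2πi k·x)` of `ℝ^ι`. -/
noncomputable def integerWave (k : ι → ℤ) (x : ι → ℝ) : ℂ := 𝐞 (intVec k ⬝ᵥ x)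

lemma continuous_integerWave (k : ι → ℤ) : Continuous (integerWave k) := by
  unfold integerWave dotProduct
  fun_prop

lemma norm_integerWave (k : ι → ℤ) (x : ι → ℝ) : ‖integerWave k x‖ = 1 := Circle.norm_coe _

lemma integerWave_eq_mFourier (k : ι → ℤ) (x : ι → ℝ) :
    integerWave k x = UnitAddTorus.mFourier k (fun i => (x i : UnitAddCircle)) := by
  simp only [integerWave, Real.fourierChar_apply, dotProduct, intVec_apply, UnitAddTorus.mFourier,
    ContinuousMap.coe_mk, fourier_coe_apply, ← Complex.exp_sum, Finset.mul_sum, Finset.sum_mul,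
    Complex.ofReal_sum]
  congr 1
  refine Finset.sum_congr rfl fun i _ => ?_
  push_cast
  ring

lemma integerWave_add_intVec (k m : ι → ℤ) (x : ι → ℝ) :
    integerWave k (x + intVec m) = integerWave k x := by
  simp only [integerWave_eq_mFourier, Pi.add_apply, intVec_apply, AddCircle.coe_add]
  congr 1
  funext i
  rw [add_eq_left, AddCircle.coe_eq_zero_iff]
  exact ⟨m i, by simp⟩

noncomputable section Torus

attribute [-instance] AddCircle.measureSpace

local instance : MeasureSpace UnitAddCircle := ⟨AddCircle.haarAddCircle⟩

local instance : Measure.IsAddHaarMeasure (volume : Measure UnitAddCircle) :=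
  inferInstanceAs (Measure.IsAddHaarMeasure AddCircle.haarAddCircle)

local instance : IsProbabilityMeasure (volume : Measure UnitAddCircle) :=
  inferInstanceAs (IsProbabilityMeasure AddCircle.haarAddCircle)

lemma measurePreserving_unitCubeRep :
    MeasurePreserving (unitCubeRep (ι := ι)) volume (volume.restrict (unitCube ι)) := by
  have h := (measurePreserving_subtype_coe (MeasurableSet.univ_pi' fun _ : ι =>
    measurableSet_Ioc (a := (0 : ℝ)) (b := 0 + 1))).comp
      (UnitAddTorus.measurePreserving_equivPiIoc (0 : ι → ℝ))
  simpa only [zero_add] using! h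

lemma integral_comp_unitCubeRep {F : (ι → ℝ) → ℂ}
    (hF : AEStronglyMeasurable F (volume.restrict (unitCube ι))) :
    ∫ t, F (unitCubeRep t) = ∫ x in unitCube ι, F x := by
  rw [← measurePreserving_unitCubeRep.map_eq] at hF ⊢
  exact (integral_map measurePreserving_unitCubeRep.aemeasurable hF).symm

lemma mFourierCoeff_comp_unitCubeRep {F : (ι → ℝ) → ℂ}
    (hF : MemLp F 2 (volume.restrict (unitCube ι))) (k : ι → ℤ) :
    UnitAddTorus.mFourierCoeff (hF.comp_measurePreserving measurePreserving_unitCubeRep).toLp (-k) =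
      ∫ x in unitCube ι, F x * integerWave k x := by
  refine (integral_congr_ae ?_).trans
    (integral_comp_unitCubeRep (hF.1.mul (continuous_integerWave k).aestronglyMeasurable))
  filter_upwards [(hF.comp_measurePreserving measurePreserving_unitCubeRep).coeFn_toLp] with t ht
  simp only [ht, integerWave_eq_mFourier, coe_unitCubeRep, neg_neg, smul_eq_mul, mul_comm,
    Function.comp_apply]

lemma hasSum_unitCube_parseval {F G : (ι → ℝ) → ℂ}
    (hF : MemLp F 2 (volume.restrict (unitCube ι)))
    (hG : MemLp G 2 (volume.restrict (unitCube ι))) :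
    HasSum (fun k : ι → ℤ => (∫ x in unitCube ι, F x * integerWave k x) *
      starRingEnd ℂ (∫ x in unitCube ι, G x * integerWave k x))
      (∫ x in unitCube ι, F x * starRingEnd ℂ (G x)) := by
  have hF' := hF.comp_measurePreserving measurePreserving_unitCubeRep
  have hG' := hG.comp_measurePreserving measurePreserving_unitCubeRep
  have parseval := (Equiv.neg (ι → ℤ)).hasSum_iff.2
    (UnitAddTorus.hasSum_prod_mFourierCoeff hG'.toLp hF'.toLp)
  convert parseval using 1
  · funext k
    simp only [Function.comp_apply, Equiv.neg_apply, mFourierCoeff_comp_unitCubeRep hF,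
      mFourierCoeff_comp_unitCubeRep hG, mul_comm]
  · refine (integral_comp_unitCubeRep (hF.1.mul hG.1.star)).symm.trans (integral_congr_ae ?_)
    filter_upwards [hF'.coeFn_toLp, hG'.coeFn_toLp] with t hFt hGt
    rw [hFt, hGt, mul_comm]
    rfl

end Torus

end UnitCube

/-! ### Parseval's identity for periodizations -/

section Periodization

open scoped Pointwise

variable {ι : Type*}

lemma eq_zero_of_mem_unitCube {x : ι → ℝ} {m : ι → ℤ} (hx : x ∈ unitCube ι)
    (hm : x + intVec m ∈ unitCube ι) : m = 0 := by
  funext i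
  have hxi := hx i
  have hmi := hm i
  simp only [Pi.add_apply, intVec_apply, Set.mem_Ioc] at hxi hmi
  have h_lt : (m i : ℝ) < 1 := by linarith
  have h_gt : (-1 : ℝ) < m i := by linarith
  norm_cast at h_lt h_gt
  simp only [Pi.zero_apply]
  omega

lemma exists_sub_intVec_mem_unitCube (x : ι → ℝ) : ∃ m, x - intVec m ∈ unitCube ι := by
  refine ⟨fun i => ⌈x i⌉ - 1, fun i => ?_⟩
  simp only [Pi.sub_apply, intVec_apply, Int.cast_sub, Int.cast_one, Set.mem_Ioc]
  constructor <;> linarith [Int.le_ceil (x i), Int.ceil_lt_add_one (x i)]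

variable [Fintype ι]

lemma hasSum_integral_unitCube {H : (ι → ℝ) → ℂ} (hH : Integrable H) :
    HasSum (fun m : ι → ℤ => ∫ x in unitCube ι, H (x + intVec m)) (∫ x, H x) := by
  have h_union : ⋃ m : ι → ℤ, (· - intVec m) ⁻¹' unitCube ι = Set.univ :=
    Set.eq_univ_of_forall fun x => Set.mem_iUnion.2 (exists_sub_intVec_mem_unitCube x)
  have h_disjoint : Pairwise
      (Function.onFun Disjoint fun m : ι → ℤ => (· - intVec m) ⁻¹' unitCube ι) := fun m n hmn =>
    Set.disjoint_left.2 fun x hxm hxn => hmn <| sub_eq_zero.1 <| eq_zero_of_mem_unitCube hxm <| by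
      rwa [map_sub, sub_add_sub_cancel]
  have h_integral : ∀ m : ι → ℤ, ∫ x in (· - intVec m) ⁻¹' unitCube ι, H x =
      ∫ x in unitCube ι, H (x + intVec m) := fun m => by
    simpa only [sub_add_cancel] using
      (measurePreserving_sub_right volume (intVec m)).setIntegral_preimage_emb
        (MeasurableEquiv.subRight (intVec m)).measurableEmbedding (fun x => H (x + intVec m)) _
  have h_cubes := hasSum_integral_iUnion (fun m => measurableSet_unitCube.preimage
    (measurable_sub_const (intVec m))) h_disjoint hH.integrableOn
  simpa only [h_union, setIntegral_univ, h_integral] using h_cubes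

lemma isometry_intVec : Isometry (intVec (ι := ι)) := Isometry.of_dist_eq fun m n => by
  simp [dist_pi_def, intVec_apply, nndist_dist]

lemma exists_finset_translates {ι : Type*} [Finite ι] {K : Set (ι → ℝ)}
    (hK : Bornology.IsBounded K) :
    ∃ s : Finset (ι → ℤ), ∀ x ∈ unitCube ι, ∀ m, x + intVec m ∈ K → m ∈ s := by
  have := Fintype.ofFinite ι
  have h_finite : (intVec ⁻¹' (K - unitCube ι)).Finite :=
    (isometry_intVec.antilipschitz.isBounded_preimage
      (hK.sub isBounded_unitCube)).isCompact_closure.finite_of_discrete.subset subset_closure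
  exact ⟨h_finite.toFinset, fun x hx m hm =>
    h_finite.mem_toFinset.2 ⟨_, hm, x, hx, add_sub_cancel_left x _⟩⟩

lemma ae_periodization_support {F : (ι → ℝ) → ℂ} {K : Set (ι → ℝ)} {s : Finset (ι → ℤ)}
    (hs : ∀ x ∈ unitCube ι, ∀ m, x + intVec m ∈ K → m ∈ s) (hF : ∀ᵐ x, x ∉ K → F x = 0) :
    ∀ᵐ x ∂volume.restrict (unitCube ι), ∀ m ∉ s, F (x + intVec m) = 0 := by
  rw [ae_restrict_iff' measurableSet_unitCube]
  have h_translates : ∀ᵐ x, ∀ m : ι → ℤ, x + intVec m ∉ K → F (x + intVec m) = 0 :=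
    ae_all_iff.2 fun m =>
      (measurePreserving_add_right volume (intVec m)).quasiMeasurePreserving.ae hF
  filter_upwards [h_translates] with x hx hxQ m hm
  exact hx m fun hmK => hm (hs x hxQ m hmK)

lemma integral_eq_sum_unitCube {H : (ι → ℝ) → ℂ} (hH : Integrable H) {s : Finset (ι → ℤ)}
    (hs : ∀ᵐ x ∂volume.restrict (unitCube ι), ∀ m ∉ s, H (x + intVec m) = 0) :
    ∫ x, H x = ∑ m ∈ s, ∫ x in unitCube ι, H (x + intVec m) :=
  (hasSum_integral_unitCube hH).unique <| hasSum_sum_of_ne_finset_zero fun m hm =>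
    integral_eq_zero_of_ae <| by filter_upwards [hs] with x hx using hx m hm

lemma memLp_comp_add {F : (ι → ℝ) → ℂ} (hF : MemLp F 2) (a : ι → ℝ) :
    MemLp (fun x => F (x + a)) 2 :=
  hF.comp_measurePreserving (measurePreserving_add_right volume a)

lemma integral_mul_integerWave {F : (ι → ℝ) → ℂ} (hF : Integrable F) {s : Finset (ι → ℤ)}
    (hs : ∀ᵐ x ∂volume.restrict (unitCube ι), ∀ m ∉ s, F (x + intVec m) = 0) (k : ι → ℤ) :
    ∫ x, F x * integerWave k x =
      ∫ x in unitCube ι, (∑ m ∈ s, F (x + intVec m)) * integerWave k x := by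
  have h_wave : ∀ {μ : Measure (ι → ℝ)} {f : (ι → ℝ) → ℂ}, Integrable f μ →
      Integrable (fun x => f x * integerWave k x) μ := fun hf =>
    hf.mul_bdd (c := 1) (continuous_integerWave k).aestronglyMeasurable
      (ae_of_all _ fun x => (norm_integerWave k x).le)
  rw [integral_eq_sum_unitCube (h_wave hF) (s := s) (by
    filter_upwards [hs] with x hx m hm using by rw [hx m hm, zero_mul])]
  simp only [Finset.sum_mul, integerWave_add_intVec]
  exact (integral_finsetSum _ fun m _ => h_wave (hF.comp_add_right _).integrableOn).symm

lemma integral_unitCube_periodization {F G : (ι → ℝ) → ℂ} (hF : MemLp F 2) (hG : MemLp G 2)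
    {s : Finset (ι → ℤ)}
    (hFs : ∀ᵐ x ∂volume.restrict (unitCube ι), ∀ m ∉ s, F (x + intVec m) = 0)
    (hGs : ∀ᵐ x ∂volume.restrict (unitCube ι), ∀ m ∉ s, G (x + intVec m) = 0) :
    ∫ x in unitCube ι, (∑ m ∈ s, F (x + intVec m)) * starRingEnd ℂ (∑ n ∈ s, G (x + intVec n)) =
      ∑' l : ι → ℤ, ∫ x, F x * starRingEnd ℂ (G (x - intVec l)) := by
  set a : (ι → ℤ) → (ι → ℤ) → ℂ := fun m n =>
    ∫ x in unitCube ι, F (x + intVec m) * starRingEnd ℂ (G (x + intVec n)) with ha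
  have h_mul : ∀ m n, Integrable fun x => F (x + intVec m) * starRingEnd ℂ (G (x + intVec n)) :=
    fun m n => (memLp_comp_add hF _).integrable_mul (memLp_comp_add hG _).star
  have h_translate : ∀ l, ∫ x, F x * starRingEnd ℂ (G (x - intVec l)) = ∑ m ∈ s, a m (m - l) := by
    intro l
    have h_int := h_mul 0 (-l)
    simp only [map_zero, add_zero, map_neg, ← sub_eq_add_neg] at h_int
    rw [integral_eq_sum_unitCube h_int (s := s) (by
      filter_upwards [hFs] with x hx m hm using by rw [hx m hm, zero_mul])]
    simp only [ha, map_sub, add_sub_assoc]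
  have h_reindex : ∀ m, HasSum (fun l => a m (m - l)) (∑ n ∈ s, a m n) := fun m =>
    (Equiv.subLeft m).hasSum_iff.2 <| hasSum_sum_of_ne_finset_zero fun n hn =>
      integral_eq_zero_of_ae <| by
        filter_upwards [hGs] with x hx using by simp [hx n hn]
  simp only [h_translate, (hasSum_sum fun m _ => h_reindex m).tsum_eq, map_sum, Finset.sum_mul_sum]
  rw [integral_finsetSum _ fun m _ => integrable_finsetSum _ fun n _ => (h_mul m n).integrableOn]
  exact Finset.sum_congr rfl fun m _ => integral_finsetSum _ fun n _ => (h_mul m n).integrableOn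

lemma integrable_of_memLp_two_of_isBounded {F : (ι → ℝ) → ℂ} {K : Set (ι → ℝ)} (hF : MemLp F 2)
    (hK : Bornology.IsBounded K) (hFK : ∀ᵐ x, x ∉ K → F x = 0) : Integrable F := by
  obtain ⟨R, hR⟩ := hK.subset_closedBall 0
  have : IsFiniteMeasure (volume.restrict (Metric.closedBall (0 : ι → ℝ) R)) :=
    ⟨by simpa using (isCompact_closedBall (0 : ι → ℝ) R).measure_lt_top⟩
  refine IntegrableOn.integrable_of_ae_notMem_eq_zero ((hF.restrict _).integrable one_le_two)
    (s := Metric.closedBall 0 R) ?_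
  filter_upwards [hFK] with x hx hxR using hx fun hxK => hxR (hR hxK)

lemma hasSum_parseval_periodization {F G : (ι → ℝ) → ℂ} {K : Set (ι → ℝ)}
    (hK : Bornology.IsBounded K) (hF : MemLp F 2) (hG : MemLp G 2)
    (hFK : ∀ᵐ x, x ∉ K → F x = 0) (hGK : ∀ᵐ x, x ∉ K → G x = 0) :
    HasSum (fun k : ι → ℤ => (∫ x, F x * integerWave k x) *
      starRingEnd ℂ (∫ x, G x * integerWave k x))
      (∑' l : ι → ℤ, ∫ x, F x * starRingEnd ℂ (G (x - intVec l))) := by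
  obtain ⟨s, hs⟩ := exists_finset_translates hK
  have hFs := ae_periodization_support hs hFK
  have hGs := ae_periodization_support hs hGK
  rw [← integral_unitCube_periodization hF hG hFs hGs]
  simp only [integral_mul_integerWave (integrable_of_memLp_two_of_isBounded hF hK hFK) hFs,
    integral_mul_integerWave (integrable_of_memLp_two_of_isBounded hG hK hGK) hGs]
  exact hasSum_unitCube_parseval
    ((memLp_finsetSum _ fun m _ => memLp_comp_add hF _).restrict _)
    ((memLp_finsetSum _ fun m _ => memLp_comp_add hG _).restrict _)

end Periodization

/-! ### Characters and general lattices -/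

section PlaneWave

variable {V : Type*} [NormedAddCommGroup V] [InnerProductSpace ℝ V]

/-- The character `ξ ↦ exp (2πi a·ξ)`. -/
noncomputable def planeWave (a ξ : V) : ℂ := 𝐞 (inner ℝ a ξ)

lemma norm_planeWave (a ξ : V) : ‖planeWave a ξ‖ = 1 := Circle.norm_coe _

lemma continuous_planeWave (a : V) : Continuous (planeWave a) := by
  unfold planeWave
  fun_prop

lemma planeWave_comm (a ξ : V) : planeWave a ξ = planeWave ξ a := by
  rw [planeWave, planeWave, real_inner_comm]

lemma planeWave_add_right (a ξ η : V) :
    planeWave a (ξ + η) = planeWave a ξ * planeWave a η := by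
  simp only [planeWave, inner_add_right, AddChar.map_add_eq_mul, Circle.coe_mul]

lemma planeWave_zero_right (a : V) : planeWave a 0 = 1 := by
  simp only [planeWave, inner_zero_right, AddChar.map_zero_eq_one, Circle.coe_one]

lemma conj_planeWave (a ξ : V) : starRingEnd ℂ (planeWave a ξ) = planeWave (-a) ξ := by
  simp only [planeWave, inner_neg_left, AddChar.map_neg_eq_inv, Circle.coe_inv_eq_conj]

end PlaneWave

section Lattice

variable {d : ℕ} {C : Matrix (Fin d) (Fin d) ℝ}

/-- The linear map `ℝᵈ → ℝᵈ` given by a matrix, from coordinate vectors with Lebesgue measure on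
`Fin d → ℝ` to the Euclidean space. -/
noncomputable def matrixMap (A : Matrix (Fin d) (Fin d) ℝ) :
    (Fin d → ℝ) →ₗ[ℝ] EuclideanSpace ℝ (Fin d) :=
  (WithLp.linearEquiv 2 ℝ (Fin d → ℝ)).symm.toLinearMap ∘ₗ A.mulVecLin

lemma latticePoint_eq_matrixMap (A : Matrix (Fin d) (Fin d) ℝ) (k : Fin d → ℤ) :
    latticePoint A k = matrixMap A (intVec k) := rfl

lemma latticePoint_neg (A : Matrix (Fin d) (Fin d) ℝ) (k : Fin d → ℤ) :
    latticePoint A (-k) = -latticePoint A k := by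
  simp only [latticePoint_eq_matrixMap, map_neg]

lemma injective_matrixMap {A : Matrix (Fin d) (Fin d) ℝ} (hA : IsUnit A.det) :
    Function.Injective (matrixMap A) :=
  (WithLp.toLp_injective 2).comp <|
    Matrix.mulVec_injective_of_isUnit ((Matrix.isUnit_iff_isUnit_det A).2 hA)

lemma measurableEmbedding_matrixMap {A : Matrix (Fin d) (Fin d) ℝ} (hA : IsUnit A.det) :
    MeasurableEmbedding (matrixMap A) :=
  (LinearMap.continuous_of_finiteDimensional _).measurableEmbedding (injective_matrixMap hA)

lemma map_matrixMap_volume {A : Matrix (Fin d) (Fin d) ℝ} (hA : IsUnit A.det) :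
    volume.map (matrixMap A) = ENNReal.ofReal |A.det⁻¹| • volume := by
  have h_comp : ⇑(matrixMap A) = WithLp.toLp 2 ∘ Matrix.toLin' A := rfl
  have h_toLp := PiLp.volume_preserving_toLp (Fin d)
  rw [h_comp, ← Measure.map_map h_toLp.measurable
      (LinearMap.continuous_of_finiteDimensional _).measurable,
    Real.map_matrix_volume_pi_eq_smul_volume_pi hA.ne_zero, Measure.map_smul, h_toLp.map_eq]

lemma memLp_comp_matrixMap {A : Matrix (Fin d) (Fin d) ℝ} (hA : IsUnit A.det) {p : ℝ≥0∞}
    {F : EuclideanSpace ℝ (Fin d) → ℂ} (hF : MemLp F p) : MemLp (F ∘ matrixMap A) p := by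
  refine (measurableEmbedding_matrixMap hA).memLp_map_measure_iff.1 ?_
  rw [map_matrixMap_volume hA]
  exact hF.smul_measure ENNReal.ofReal_ne_top

lemma ae_comp_matrixMap {A : Matrix (Fin d) (Fin d) ℝ} (hA : IsUnit A.det)
    {q : EuclideanSpace ℝ (Fin d) → Prop} (hq : ∀ᵐ ξ, q ξ) : ∀ᵐ η, q (matrixMap A η) := by
  rw [← (measurableEmbedding_matrixMap hA).ae_map_iff, map_matrixMap_volume hA]
  exact Measure.ae_smul_measure hq _

lemma isBounded_preimage_matrixMap {A : Matrix (Fin d) (Fin d) ℝ} (hA : IsUnit A.det)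
    {K : Set (EuclideanSpace ℝ (Fin d))} (hK : Bornology.IsBounded K) :
    Bornology.IsBounded (matrixMap A ⁻¹' K) := by
  obtain ⟨c, -, h_antilipschitz⟩ :=
    (matrixMap A).exists_antilipschitzWith (LinearMap.ker_eq_bot.2 (injective_matrixMap hA))
  exact h_antilipschitz.isBounded_preimage hK

lemma isUnit_det_dualMatrix (hC : IsUnit C.det) : IsUnit (dualMatrix C).det :=
  Matrix.isUnit_nonsing_inv_det _ (by rwa [Matrix.det_transpose])

lemma integral_comp_dualMatrixMap (hC : IsUnit C.det) (H : EuclideanSpace ℝ (Fin d) → ℂ) :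
    ∫ ξ, H ξ = ((|C.det|⁻¹ : ℝ) : ℂ) * ∫ η, H (matrixMap (dualMatrix C) η) := by
  rw [← (measurableEmbedding_matrixMap (isUnit_det_dualMatrix hC)).integral_map,
    map_matrixMap_volume (isUnit_det_dualMatrix hC), integral_smul_measure, dualMatrix,
    Matrix.det_nonsing_inv, Matrix.det_transpose, Ring.inverse_eq_inv', inv_inv,
    ENNReal.toReal_ofReal (abs_nonneg _), Complex.real_smul, ← mul_assoc, ← Complex.ofReal_mul,
    inv_mul_cancel₀ (abs_ne_zero.2 hC.ne_zero), Complex.ofReal_one, one_mul]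

lemma planeWave_dualMatrixMap (hC : IsUnit C.det) (k : Fin d → ℤ) (η : Fin d → ℝ) :
    planeWave (latticePoint C k) (matrixMap (dualMatrix C) η) = integerWave k η := by
  have h : inner ℝ (latticePoint C k) (matrixMap (dualMatrix C) η) = intVec k ⬝ᵥ η := by
    change inner ℝ (WithLp.toLp 2 (C *ᵥ intVec k)) (WithLp.toLp 2 ((Cᵀ)⁻¹ *ᵥ η)) = _
    rw [EuclideanSpace.inner_toLp_toLp, star_trivial, dotProduct_comm, Matrix.dotProduct_mulVec,
      Matrix.vecMul_mulVec, Matrix.mul_nonsing_inv _ (by rwa [Matrix.det_transpose]),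
      Matrix.vecMul_one]
  rw [planeWave, h, integerWave]

lemma hasSum_parseval_lattice (hC : IsUnit C.det) {F G : EuclideanSpace ℝ (Fin d) → ℂ}
    {K : Set (EuclideanSpace ℝ (Fin d))} (hK : Bornology.IsBounded K) (hF : MemLp F 2)
    (hG : MemLp G 2) (hFK : ∀ᵐ ξ, ξ ∉ K → F ξ = 0) (hGK : ∀ᵐ ξ, ξ ∉ K → G ξ = 0) :
    HasSum (fun k : Fin d → ℤ => (∫ ξ, F ξ * planeWave (latticePoint C k) ξ) *
      starRingEnd ℂ (∫ ξ, G ξ * planeWave (latticePoint C k) ξ))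
      (∑' l : Fin d → ℤ, ((|C.det|⁻¹ : ℝ) : ℂ) *
        ∫ ξ, F ξ * starRingEnd ℂ (G (ξ - latticePoint (dualMatrix C) l))) := by
  have hD := isUnit_det_dualMatrix hC
  have h_parseval := hasSum_parseval_periodization (isBounded_preimage_matrixMap hD hK)
    (memLp_comp_matrixMap hD hF) (memLp_comp_matrixMap hD hG) (ae_comp_matrixMap hD hFK)
    (ae_comp_matrixMap hD hGK)
  convert! h_parseval.mul_left (((|C.det|⁻¹ : ℝ) : ℂ) ^ 2) using 1
  · funext k
    rw [integral_comp_dualMatrixMap hC, integral_comp_dualMatrixMap hC (fun ξ => G ξ * _)]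
    simp only [planeWave_dualMatrixMap hC, map_mul, Complex.conj_ofReal, Function.comp_apply]
    ring
  · rw [← tsum_mul_left]
    refine tsum_congr fun l => ?_
    rw [integral_comp_dualMatrixMap hC, latticePoint_eq_matrixMap, sq, mul_assoc]
    simp only [← map_sub, Function.comp_apply]

end Lattice

/-! ### Translation in the frequency domain -/

section Translation

variable {d : ℕ}

lemma memLp_planeWave_mul (a : EuclideanSpace ℝ (Fin d)) {F : EuclideanSpace ℝ (Fin d) → ℂ}
    {p : ℝ≥0∞} (hF : MemLp F p) : MemLp (fun ξ => planeWave a ξ * F ξ) p := by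
  refine hF.of_le ((continuous_planeWave a).aestronglyMeasurable.mul hF.1) (ae_of_all _ fun ξ => ?_)
  rw [norm_mul, norm_planeWave, one_mul]

/-- Multiplication by the character `planeWave a` on `L²`. -/
noncomputable def modulateL2 (a : EuclideanSpace ℝ (Fin d)) (f : L2 d) : L2 d :=
  (memLp_planeWave_mul a (Lp.memLp f)).toLp

lemma coeFn_modulateL2 (a : EuclideanSpace ℝ (Fin d)) (f : L2 d) :
    modulateL2 a f =ᵐ[volume] fun ξ => planeWave a ξ * f ξ :=
  MemLp.coeFn_toLp _

lemma isometry_modulateL2 (a : EuclideanSpace ℝ (Fin d)) : Isometry (modulateL2 a) := by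
  intro f g
  rw [modulateL2, modulateL2, Lp.edist_toLp_toLp, Lp.edist_def]
  refine eLpNorm_congr_norm_ae (ae_of_all _ fun ξ => ?_)
  simp only [Pi.sub_apply, ← mul_sub, norm_mul, norm_planeWave, one_mul]

lemma fourier_translateL2 (a : EuclideanSpace ℝ (Fin d)) (f : L2 d) :
    (𝓕 (translateL2 a f) : L2 d) = modulateL2 (-a) (𝓕 f) := by
  refine DenseRange.induction_on (p := fun f : L2 d =>
    (𝓕 (translateL2 a f) : L2 d) = modulateL2 (-a) (𝓕 f))
    (SchwartzMap.denseRange_toLpCLM (p := 2) ENNReal.ofNat_ne_top) f ?_ fun φ => ?_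
  · have h_fourier := (Lp.fourierTransformₗᵢ (EuclideanSpace ℝ (Fin d)) ℂ).continuous
    exact isClosed_eq (h_fourier.comp (Lp.isometry_compMeasurePreserving _).continuous)
      ((isometry_modulateL2 (-a)).continuous.comp h_fourier)
  · have h_translate : translateL2 a (φ.toLp 2) = (φ.compSubConstCLM ℂ a).toLp 2 := rfl
    rw [SchwartzMap.toLpCLM_apply, h_translate, SchwartzMap.toLp_fourier_eq,
      SchwartzMap.toLp_fourier_eq]
    refine Lp.ext ?_
    filter_upwards [coeFn_modulateL2 (-a) ((𝓕 φ).toLp 2), (𝓕 φ).coeFn_toLp 2 volume,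
      (𝓕 (φ.compSubConstCLM ℂ a)).coeFn_toLp 2 volume] with ξ h_mod h_φ h_comp
    rw [h_comp, h_mod, h_φ, SchwartzMap.fourier_coe, SchwartzMap.fourier_coe]
    exact congrFun (VectorFourier.fourierIntegral_comp_add_right Real.fourierChar
      (volume : Measure (EuclideanSpace ℝ (Fin d))) (innerₗ _) φ (-a)) ξ

lemma fourier_translateL2_ae (a : EuclideanSpace ℝ (Fin d)) (f : L2 d) :
    (𝓕 (translateL2 a f) : L2 d) =ᵐ[volume] fun ξ => planeWave (-a) ξ * (𝓕 f : L2 d) ξ := by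
  rw [fourier_translateL2]
  exact coeFn_modulateL2 _ _

lemma inner_eq_integral_fourier (g f : L2 d) :
    inner ℂ g f = ∫ ξ, (𝓕 f : L2 d) ξ * starRingEnd ℂ ((𝓕 g : L2 d) ξ) := by
  rw [← Lp.inner_fourier_eq, L2.inner_def]
  rfl

lemma inner_translateL2 (a : EuclideanSpace ℝ (Fin d)) (g f : L2 d) :
    inner ℂ (translateL2 a g) f =
      ∫ ξ, (𝓕 f : L2 d) ξ * starRingEnd ℂ ((𝓕 g : L2 d) ξ) * planeWave a ξ := by
  rw [inner_eq_integral_fourier]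
  refine integral_congr_ae ?_
  filter_upwards [fourier_translateL2_ae a g] with ξ hξ
  rw [hξ, map_mul, conj_planeWave, neg_neg]
  ring

end Translation

/-! ### Fourier coefficients of almost periodic functions -/

section AlmostPeriodic

variable {V : Type*} [NormedAddCommGroup V] [InnerProductSpace ℝ V] [MeasurableSpace V]
  [BorelSpace V]

lemma integrable_planeWave_left {μ : Measure V} [IsFiniteMeasure μ] [SecondCountableTopology V]
    (v : V) : Integrable (fun a => planeWave a v) μ := by
  simp only [planeWave_comm _ v]
  exact .of_bound (continuous_planeWave v).aestronglyMeasurable 1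
    (ae_of_all _ fun a => (norm_planeWave v a).le)

variable [FiniteDimensional ℝ V]

variable (V) in
/-- The uniform probability distribution on the closed unit ball. -/
noncomputable def unitBallMeasure : Measure V :=
  ProbabilityTheory.cond volume (Metric.closedBall (0 : V) 1)

instance isProbabilityMeasure_unitBallMeasure : IsProbabilityMeasure (unitBallMeasure V) :=
  ProbabilityTheory.cond_isProbabilityMeasure_of_finite
    (Metric.measure_closedBall_pos volume (0 : V) one_pos).ne'
    (isCompact_closedBall (0 : V) 1).measure_lt_top.ne

/-- The mean value over the unit ball of the character `planeWave v`; its values at the multiples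
`n • v` are the mean values of that character over the balls of radius `n`. -/
noncomputable def ballMean (v : V) : ℂ := ∫ a, planeWave a v ∂unitBallMeasure V

lemma norm_ballMean_le_one (v : V) : ‖ballMean v‖ ≤ 1 :=
  (norm_integral_le_of_norm_le_const (ae_of_all _ fun a => (norm_planeWave a v).le)).trans_eq
    (by rw [probReal_univ, one_mul])

lemma ballMean_zero : ballMean (0 : V) = 1 := by
  simp only [ballMean, planeWave_zero_right, integral_const, probReal_univ, one_smul]

lemma tendsto_ballMean_smul {v : V} (hv : v ≠ 0) :
    Filter.Tendsto (fun n : ℕ => ballMean ((n : ℝ) • v)) Filter.atTop (𝓝 0) := by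
  have h_cocompact : Filter.Tendsto (fun n : ℕ => -((n : ℝ) • v)) Filter.atTop
      (Filter.cocompact V) := by
    rw [← Metric.cobounded_eq_cocompact, ← tendsto_norm_atTop_iff_cobounded]
    simp only [norm_neg, norm_smul, Real.norm_natCast]
    exact tendsto_natCast_atTop_atTop.atTop_mul_const (norm_pos_iff.2 hv)
  have riemann_lebesgue := (tendsto_integral_exp_inner_smul_cocompact
    ((Metric.closedBall (0 : V) 1).indicator fun _ => (1 : ℂ))).comp h_cocompact
  have h_mean := riemann_lebesgue.const_smul (volume (Metric.closedBall (0 : V) 1))⁻¹.toReal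
  rw [smul_zero] at h_mean
  refine h_mean.congr fun n => ?_
  rw [ballMean, unitBallMeasure, ProbabilityTheory.cond, integral_smul_measure,
    ← integral_indicator Metric.isClosed_closedBall.measurableSet]
  congr 1
  refine integral_congr_ae (ae_of_all _ fun a => ?_)
  by_cases ha : a ∈ Metric.closedBall (0 : V) 1
  · simp [ha, planeWave, Circle.smul_def]
  · simp [ha]

lemma tendsto_ballMean_smul_ite [DecidableEq V] (v : V) :
    Filter.Tendsto (fun n : ℕ => ballMean ((n : ℝ) • v)) Filter.atTop
      (𝓝 (if v = 0 then 1 else 0)) := by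
  split_ifs with hv
  · simp only [hv, smul_zero, ballMean_zero, tendsto_const_nhds]
  · exact tendsto_ballMean_smul hv

variable {J : Type*} [Countable J] {β : J → V} {c : J → ℂ}

lemma hasSum_ballMean_mul (hc : Summable fun j => ‖c j‖) {F : V → ℂ}
    (hF : ∀ a, HasSum (fun j => planeWave a (β j) * c j) (F a)) :
    HasSum (fun j => ballMean (β j) * c j) (∫ a, F a ∂unitBallMeasure V) := by
  simp only [ballMean, ← integral_mul_const, ← (hF _).tsum_eq]
  refine hasSum_integral_of_summable_integral_norm
    (fun j => (integrable_planeWave_left (β j)).mul_const _) ?_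
  simpa only [norm_mul, norm_planeWave, one_mul, integral_const, probReal_univ, one_smul]

-- Averaging the constant function times `planeWave (-α)` over large balls isolates the
-- coefficients of frequency `α`.
lemma tsum_frequency_fiber_eq [DecidableEq V] (hc : Summable fun j => ‖c j‖) {w : ℂ}
    (hw : ∀ a, HasSum (fun j => planeWave a (β j) * c j) w) (α : V) :
    ∑' j : β ⁻¹' {α}, c j = if α = 0 then w else 0 := by
  have h_mean (n : ℕ) : HasSum (fun j => ballMean ((n : ℝ) • (β j - α)) * c j)
      (ballMean ((n : ℝ) • -α) * w) := by
    have h := hasSum_ballMean_mul (β := fun j => (n : ℝ) • (β j - α)) hc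
      (F := fun a => planeWave a ((n : ℝ) • -α) * w) fun a =>
        ((hw ((n : ℝ) • a)).mul_left (planeWave a ((n : ℝ) • -α))).congr_fun fun j => by
          have h_smul : planeWave ((n : ℝ) • a) (β j) = planeWave a ((n : ℝ) • β j) := by
            simp only [planeWave, inner_smul_left, inner_smul_right, conj_trivial]
          rw [h_smul, ← mul_assoc, ← planeWave_add_right, ← smul_add, neg_add_eq_sub]
    rwa [integral_mul_const] at h
  have h_fiber : Filter.Tendsto (fun n : ℕ => ∑' j, ballMean ((n : ℝ) • (β j - α)) * c j)
      Filter.atTop (𝓝 (∑' j, (if β j - α = 0 then 1 else 0) * c j)) :=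
    tendsto_tsum_of_dominated_convergence hc
      (fun j => (tendsto_ballMean_smul_ite (β j - α)).mul_const (c j))
      (.of_forall fun n j => by
        rw [norm_mul]
        exact mul_le_of_le_one_left (norm_nonneg _) (norm_ballMean_le_one _))
  simp only [fun n => (h_mean n).tsum_eq] at h_fiber
  have h_unique := tendsto_nhds_unique h_fiber ((tendsto_ballMean_smul_ite (-α)).mul_const w)
  simp only [ite_mul, one_mul, zero_mul, neg_eq_zero, sub_eq_zero] at h_unique
  rw [tsum_subtype (β ⁻¹' {α}) c, ← h_unique]
  refine tsum_congr fun j => ?_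
  simp only [Set.indicator, Set.mem_preimage, Set.mem_singleton_iff]

end AlmostPeriodic

/-! ### Test vectors -/

lemma ae_eq_zero_of_forall_setIntegral_eq_zero_of_aecover {X : Type*} [MeasurableSpace X]
    {μ : Measure X} {E : Set X} (hE : MeasurableSet E) {K : ℕ → Set X}
    (hK : AECover μ Filter.atTop K) {w : X → ℂ} (hw : ∀ n, IntegrableOn w (E ∩ K n) μ)
    (h_zero : ∀ n A, MeasurableSet A → A ⊆ E ∩ K n → ∫ x in A, w x ∂μ = 0) :
    ∀ᵐ x ∂μ, x ∈ E → w x = 0 := by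
  have h_piece (n : ℕ) : ∀ᵐ x ∂μ, x ∈ E ∩ K n → w x = 0 := by
    have h_meas := hE.inter (hK.measurableSet n)
    rw [← ae_restrict_iff' h_meas]
    refine (hw n).ae_eq_zero_of_forall_setIntegral_eq_zero fun s hs _ => ?_
    rw [Measure.restrict_restrict hs]
    exact h_zero n _ (hs.inter h_meas) Set.inter_subset_right
  filter_upwards [ae_all_iff.2 h_piece, hK.ae_eventually_mem] with x hx h_mem hxE
  obtain ⟨n, hn⟩ := h_mem.exists
  exact hx n ⟨hxE, hn⟩

section TestVector

variable {d : ℕ} {A E K : Set (EuclideanSpace ℝ (Fin d))} {f : L2 d}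

lemma mem_bandSpace : f ∈ bandSpace E ↔ ∀ᵐ ξ, ξ ∉ E → (𝓕 f : L2 d) ξ = 0 := Iff.rfl

lemma mem_bandSpace_univ (f : L2 d) : f ∈ bandSpace Set.univ :=
  ae_of_all _ fun ξ hξ => absurd (Set.mem_univ ξ) hξ

lemma bandSpace_mono (hEK : E ⊆ K) : bandSpace E ≤ bandSpace K := fun _ hf =>
  (mem_bandSpace.1 hf).mono fun _ h hξ => h fun hE => hξ (hEK hE)

lemma translateL2_mem_bandSpace (a : EuclideanSpace ℝ (Fin d)) (hf : f ∈ bandSpace E) :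
    translateL2 a f ∈ bandSpace E := by
  filter_upwards [fourier_translateL2_ae a f, mem_bandSpace.1 hf] with ξ h_translate h hξ
  rw [h_translate, h hξ, mul_zero]

/-- The vectors on which the weak form of the duality relation is tested: the Fourier transform is
essentially bounded and vanishes outside `K`. -/
def IsTestVector (K : Set (EuclideanSpace ℝ (Fin d))) (f : L2 d) : Prop :=
  f ∈ bandSpace K ∧ MemLp (𝓕 f : L2 d) ∞ volume

lemma IsTestVector.mono (hf : IsTestVector E f) (hEK : E ⊆ K) : IsTestVector K f :=
  ⟨bandSpace_mono hEK hf.1, hf.2⟩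

lemma IsTestVector.translateL2 (hf : IsTestVector K f) (a : EuclideanSpace ℝ (Fin d)) :
    IsTestVector K (translateL2 a f) :=
  ⟨translateL2_mem_bandSpace a hf.1,
    (memLp_congr_ae (fourier_translateL2_ae a f)).2 (memLp_planeWave_mul (-a) hf.2)⟩

/-- The vector whose Fourier transform is the indicator function of `A`. -/
noncomputable def fourierIndicator (hA : MeasurableSet A) (hA_fin : volume A ≠ ∞) : L2 d :=
  𝓕⁻ (indicatorConstLp 2 hA hA_fin (1 : ℂ))

variable (hA : MeasurableSet A) (hA_fin : volume A ≠ ∞)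

lemma fourier_fourierIndicator :
    (𝓕 (fourierIndicator hA hA_fin) : L2 d) = indicatorConstLp 2 hA hA_fin 1 :=
  FourierTransform.fourier_fourierInv_eq _

lemma fourier_fourierIndicator_ae :
    (𝓕 (fourierIndicator hA hA_fin) : L2 d) =ᵐ[volume] A.indicator fun _ => 1 := by
  rw [fourier_fourierIndicator]
  exact indicatorConstLp_coeFn

lemma isTestVector_fourierIndicator : IsTestVector A (fourierIndicator hA hA_fin) := by
  refine ⟨?_, (memLp_congr_ae (fourier_fourierIndicator_ae hA hA_fin)).2
    (memLp_indicator_const _ hA _ (Or.inr hA_fin))⟩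
  filter_upwards [fourier_fourierIndicator_ae hA hA_fin] with ξ h hξ
  rw [h, Set.indicator_of_notMem hξ]

lemma inner_fourierIndicator (f : L2 d) :
    inner ℂ (fourierIndicator hA hA_fin) f = ∫ ξ in A, (𝓕 f : L2 d) ξ := by
  rw [← Lp.inner_fourier_eq, fourier_fourierIndicator, L2.inner_indicatorConstLp_one]

end TestVector

section Density

variable {d : ℕ} {E : Set (EuclideanSpace ℝ (Fin d))} {K : ℕ → Set (EuclideanSpace ℝ (Fin d))}

lemma inner_eq_zero_of_mem_bandSpace (hE : MeasurableSet E) (hK : AECover volume Filter.atTop K)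
    (hK_fin : ∀ n, volume (K n) ≠ ∞) {x : L2 d}
    (hx : ∀ n f, f ∈ bandSpace E → IsTestVector (K n) f → inner ℂ f x = 0) {f : L2 d}
    (hf : f ∈ bandSpace E) : inner ℂ x f = 0 := by
  have h_vanish : ∀ᵐ ξ, ξ ∈ E → (𝓕 x : L2 d) ξ = 0 := by
    refine ae_eq_zero_of_forall_setIntegral_eq_zero_of_aecover hE hK
      (fun n => integrableOn_Lp_of_measure_ne_top _ one_le_two
        (measure_ne_top_of_subset Set.inter_subset_right (hK_fin n)))
      fun n A hA hAK => ?_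
    have hA_fin := measure_ne_top_of_subset (hAK.trans Set.inter_subset_right) (hK_fin n)
    have h_test := isTestVector_fourierIndicator hA hA_fin
    rw [← inner_fourierIndicator hA hA_fin]
    exact hx n _ (bandSpace_mono (hAK.trans Set.inter_subset_left) h_test.1)
      (h_test.mono (hAK.trans Set.inter_subset_right))
  rw [inner_eq_integral_fourier]
  refine integral_eq_zero_of_ae ?_
  filter_upwards [h_vanish, mem_bandSpace.1 hf] with ξ hξ hfξ
  by_cases hξE : ξ ∈ E
  · simp only [hξ hξE, map_zero, mul_zero, Pi.zero_apply]
  · simp only [hfξ hξE, zero_mul, Pi.zero_apply]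

lemma eq_zero_on_bandSpace_of_forall_inner_eq_zero (hE : MeasurableSet E)
    (hK : AECover volume Filter.atTop K) (hK_mono : Monotone K) (hK_fin : ∀ n, volume (K n) ≠ ∞)
    (T : L2 d →L[ℂ] L2 d)
    (hT : ∀ n f u, f ∈ bandSpace E → IsTestVector (K n) f → IsTestVector (K n) u →
      inner ℂ u (T f) = 0) {f : L2 d} (hf : f ∈ bandSpace E) : T f = 0 := by
  have h_test (n : ℕ) (f : L2 d) (hf : f ∈ bandSpace E) (hfK : IsTestVector (K n) f) :
      T f = 0 := by
    refine inner_self_eq_zero.1 (inner_eq_zero_of_mem_bandSpace .univ hK hK_fin (fun m u _ hu => ?_)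
      (mem_bandSpace_univ _))
    exact hT (max n m) f u hf (hfK.mono (hK_mono (le_max_left n m)))
      (hu.mono (hK_mono (le_max_right n m)))
  refine ext_inner_left ℂ fun v => ?_
  rw [inner_zero_right, ← ContinuousLinearMap.adjoint_inner_left]
  refine inner_eq_zero_of_mem_bandSpace hE hK hK_fin (fun n u hu huK => ?_) hf
  rw [ContinuousLinearMap.adjoint_inner_right, h_test n u hu huK, inner_zero_left]

end Density

/-! ### The local integrability condition -/

section EssSupport

variable {d : ℕ}

lemma isClosed_essSupport (u : EuclideanSpace ℝ (Fin d) → ℂ) : IsClosed (essSupport u) := by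
  rw [← isOpen_compl_iff, isOpen_iff_mem_nhds]
  intro ξ hξ
  simp only [essSupport, Set.mem_compl_iff, Set.mem_ofPred_eq, not_forall, not_not] at hξ
  obtain ⟨U, hU, hu⟩ := hξ
  filter_upwards [eventually_mem_nhds_iff.2 hU] with η hη h
  exact h U hη hu

lemma essSupport_subset {u : EuclideanSpace ℝ (Fin d) → ℂ} {K : Set (EuclideanSpace ℝ (Fin d))}
    (hK : IsClosed K) (hu : ∀ᵐ ξ, ξ ∉ K → u ξ = 0) : essSupport u ⊆ K := by
  intro ξ hξ
  by_contra hξK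
  exact hξ Kᶜ (hK.isOpen_compl.mem_nhds hξK) hu

lemma ae_mem_essSupport (u : EuclideanSpace ℝ (Fin d) → ℂ) :
    ∀ᵐ ξ, u ξ ≠ 0 → ξ ∈ essSupport u := by
  rw [ae_iff]
  refine measure_null_of_locally_null _ fun ξ hξ => ?_
  have h_notMem : ξ ∉ essSupport u := fun h => hξ fun _ => h
  simp only [essSupport, Set.mem_ofPred_eq, not_forall, not_not] at h_notMem
  obtain ⟨U, hU, hu⟩ := h_notMem
  refine ⟨U ∩ {η | ¬(u η ≠ 0 → η ∈ essSupport u)},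
    Filter.inter_mem (mem_nhdsWithin_of_mem_nhds hU) self_mem_nhdsWithin, ?_⟩
  rw [measure_eq_zero_iff_ae_notMem]
  filter_upwards [hu] with η hη h_mem
  exact h_mem.2 fun h_ne => absurd (hη h_mem.1) h_ne

end EssSupport

section ShiftIntegrable

variable {d : ℕ} {P : Type*} {C : P → Matrix (Fin d) (Fin d) ℝ} {g : P → L2 d}
  {K : Set (EuclideanSpace ℝ (Fin d))}

variable (C) in
/-- The frequency `C_p' k` attached to the index `(p, k)`. -/
noncomputable def frequency (j : P × (Fin d → ℤ)) : EuclideanSpace ℝ (Fin d) :=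
  latticePoint (dualMatrix (C j.1)) j.2

variable (C g) in
/-- The density `|det C_p|⁻¹ |ĝ_p|²` from the local integrability condition. -/
noncomputable def fourierEnergy (p : P) (ξ : EuclideanSpace ℝ (Fin d)) : ℝ≥0∞ :=
  ENNReal.ofReal (|(C p).det|⁻¹) * ‖(𝓕 (g p) : L2 d) ξ‖ₑ ^ 2

variable (C g K) in
/-- The local integrability condition for a vector `f` whose Fourier transform is the indicator
function of `K`. -/
def ShiftIntegrableOn : Prop :=
  ∑' j : P × (Fin d → ℤ), ∫⁻ ξ in K ∩ (· + frequency C j) ⁻¹' K, fourierEnergy C g j.1 ξ ≠ ∞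

lemma aemeasurable_fourierEnergy (p : P) : AEMeasurable (fourierEnergy C g p) :=
  ((Lp.aestronglyMeasurable _).enorm.pow_const 2).const_mul _

lemma frequency_zero_right (p : P) : frequency C (p, 0) = 0 := by
  rw [frequency, latticePoint_eq_matrixMap, map_zero, map_zero]

lemma frequency_neg_right (p : P) (k : Fin d → ℤ) : frequency C (p, -k) = -frequency C (p, k) :=
  latticePoint_neg _ k

lemma mem_testClass_fourierIndicator (hK : IsCompact K) (h0 : (0 : EuclideanSpace ℝ (Fin d)) ∉ K) :
    fourierIndicator hK.measurableSet hK.measure_lt_top.ne ∈ testClass d := by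
  have h_test := isTestVector_fourierIndicator hK.measurableSet hK.measure_lt_top.ne
  have h_subset := essSupport_subset hK.isClosed (mem_bandSpace.1 h_test.1)
  exact ⟨h_test.2, hK.of_isClosed_subset (isClosed_essSupport _) h_subset, fun h => h0 (h_subset h)⟩

lemma LocallyIntegrableSystem.shiftIntegrableOn (hg : LocallyIntegrableSystem C g)
    (hK : IsCompact K) (h0 : (0 : EuclideanSpace ℝ (Fin d)) ∉ K) : ShiftIntegrableOn C g K := by
  have h_indicator := fourier_fourierIndicator_ae hK.measurableSet hK.measure_lt_top.ne
  have h_bound := hg _ (mem_testClass_fourierIndicator hK h0)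
  set f := fourierIndicator hK.measurableSet hK.measure_lt_top.ne
  refine ne_top_of_le_ne_top h_bound.ne ?_
  have h_support : K ≤ᵐ[volume] essSupport (𝓕 f : L2 d) := by
    filter_upwards [h_indicator, ae_mem_essSupport (𝓕 f : L2 d)] with ξ h_eq h_mem hξ
    refine h_mem ?_
    rw [h_eq, Set.indicator_of_mem (s := K) hξ]
    exact one_ne_zero
  rw [ENNReal.tsum_prod']
  refine ENNReal.tsum_le_tsum fun p => ENNReal.tsum_le_tsum fun k => ?_
  refine le_trans ?_ (lintegral_mono_set' h_support)
  have h_shift := measurable_add_const (frequency C (p, k)) hK.measurableSet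
  rw [Set.inter_comm, ← setLIntegral_indicator h_shift]
  refine lintegral_mono_ae (ae_restrict_of_ae ?_)
  filter_upwards [(measurePreserving_add_right volume
    (frequency C (p, k))).quasiMeasurePreserving.ae h_indicator] with ξ hξ
  by_cases h_mem : ξ ∈ (· + frequency C (p, k)) ⁻¹' K
  · have h_one : (𝓕 f : L2 d) (ξ + latticePoint (dualMatrix (C p)) k) = 1 :=
      hξ.trans (Set.indicator_of_mem (s := K) h_mem _)
    rw [Set.indicator_of_mem h_mem, h_one, enorm_one, one_pow, one_mul, fourierEnergy]
  · rw [Set.indicator_of_notMem h_mem]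
    exact zero_le

-- In dimension `0` the test class is trivial, since no nonempty support avoids the origin, and the
-- local integrability condition is void; the Bessel property takes its place.
lemma IsBessel.shiftIntegrableOn {C : P → Matrix (Fin 0) (Fin 0) ℝ} {g : P → L2 0}
    (hg : IsBessel (translationSystem C g)) (K : Set (EuclideanSpace ℝ (Fin 0))) :
    ShiftIntegrableOn C g K := by
  have h_integral (F : EuclideanSpace ℝ (Fin 0) → ℂ) : ∫ ξ, F ξ = F 0 := by
    rw [volume_euclideanSpace_eq_dirac, integral_dirac]
  have h_lintegral (F : EuclideanSpace ℝ (Fin 0) → ℝ≥0∞) : ∫⁻ ξ, F ξ = F 0 := by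
    rw [volume_euclideanSpace_eq_dirac, lintegral_dirac]
  have h_ae : ae (volume : Measure (EuclideanSpace ℝ (Fin 0))) = pure 0 := by
    rw [volume_euclideanSpace_eq_dirac, ae_dirac_eq]
  obtain ⟨B, hB⟩ := hg
  have h_fin : volume (Set.univ : Set (EuclideanSpace ℝ (Fin 0))) ≠ ∞ := by
    rw [volume_euclideanSpace_eq_dirac]
    exact measure_ne_top _ _
  have h_summable := ((hB (fourierIndicator .univ h_fin)).1).tsum_ofReal_ne_top
  refine ne_top_of_le_ne_top h_summable (ENNReal.tsum_le_tsum fun j => ?_)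
  rw [ENNReal.ofReal_pow (norm_nonneg _), ofReal_norm, translationSystem, inner_translateL2]
  have h_indicator : (𝓕 (fourierIndicator .univ h_fin) : L2 0) 0 = 1 := by
    have h := fourier_fourierIndicator_ae .univ h_fin
    rw [Filter.EventuallyEq, Filter.Eventually, h_ae] at h
    exact h.trans (Set.indicator_of_mem (Set.mem_univ _) _)
  rw [h_integral, h_indicator, one_mul, enorm_mul, RCLike.enorm_conj,
    ← ofReal_norm (planeWave _ _), norm_planeWave, ENNReal.ofReal_one, mul_one]
  refine (setLIntegral_le_lintegral _ _).trans_eq ?_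
  rw [h_lintegral, fourierEnergy, Matrix.det_isEmpty, abs_one, inv_one, ENNReal.ofReal_one,
    one_mul]

lemma shiftIntegrableOn_of_isCompact (hgB : IsBessel (translationSystem C g))
    (hgL : LocallyIntegrableSystem C g) (hK : IsCompact K)
    (h0 : d = 0 ∨ (0 : EuclideanSpace ℝ (Fin d)) ∉ K) : ShiftIntegrableOn C g K := by
  rcases h0 with rfl | h0
  · exact hgB.shiftIntegrableOn K
  · exact hgL.shiftIntegrableOn hK h0

end ShiftIntegrable

section Exhaustion

lemma exists_aecover_isCompact (d : ℕ) : ∃ K : ℕ → Set (EuclideanSpace ℝ (Fin d)),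
    AECover volume Filter.atTop K ∧ Monotone K ∧ (∀ n, IsCompact (K n)) ∧
      ∀ n, d = 0 ∨ (0 : EuclideanSpace ℝ (Fin d)) ∉ K n := by
  rcases Nat.eq_zero_or_pos d with rfl | hd
  · exact ⟨fun _ => Set.univ, ⟨ae_of_all _ fun _ => .of_forall fun _ => trivial, fun _ => .univ⟩,
      fun _ _ _ => le_rfl, fun _ => (Set.toFinite _).isCompact, fun _ => .inl rfl⟩
  have : Nonempty (Fin d) := ⟨⟨0, hd⟩⟩
  have h_radius : Filter.Tendsto (fun n : ℕ => (n : ℝ)) Filter.atTop Filter.atTop :=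
    tendsto_natCast_atTop_atTop
  refine ⟨fun n => Metric.closedBall 0 n \ Metric.ball 0 (1 / (n + 1)),
    ⟨?_, fun n => measurableSet_closedBall.diff measurableSet_ball⟩, fun m n hmn => ?_,
    fun n => (isCompact_closedBall 0 _).diff Metric.isOpen_ball, fun n => .inr fun h => h.2 ?_⟩
  · filter_upwards [(aecover_closedBall (μ := volume) h_radius).ae_eventually_mem,
      Measure.ae_ne volume (0 : EuclideanSpace ℝ (Fin d))] with ξ h_ball h_ne
    filter_upwards [h_ball, tendsto_one_div_add_atTop_nhds_zero_nat.eventually_le_const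
      (norm_pos_iff.2 h_ne)] with n hn h_inv
    exact ⟨hn, by rwa [mem_ball_zero_iff, not_lt]⟩
  · refine Set.sdiff_subset_sdiff (Metric.closedBall_subset_closedBall (Nat.cast_le.2 hmn))
      (Metric.ball_subset_ball ?_)
    exact one_div_le_one_div_of_le (by positivity) (by gcongr)
  · exact Metric.mem_ball_self (by positivity)

end Exhaustion

/-! ### The mixed frame operator in the frequency domain -/

section CrossTerms

variable {d : ℕ} {P : Type*} (C : P → Matrix (Fin d) (Fin d) ℝ) (g h : P → L2 d)

/-- The product of `f̂` with the conjugate of the translate by `α` of `û`. -/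
noncomputable def crossProduct (f u : L2 d) (α ξ : EuclideanSpace ℝ (Fin d)) : ℂ :=
  (𝓕 f : L2 d) ξ * starRingEnd ℂ ((𝓕 u : L2 d) (ξ - α))

/-- The `p`-th summand of the series in the duality conditions. -/
noncomputable def dualTerm (α : EuclideanSpace ℝ (Fin d)) (p : P)
    (ξ : EuclideanSpace ℝ (Fin d)) : ℂ :=
  ((|(C p).det|⁻¹ : ℝ) : ℂ) * starRingEnd ℂ ((𝓕 (h p) : L2 d) (ξ - α)) * (𝓕 (g p) : L2 d) ξ

/-- The contribution of the index `(p, k)` with `C_p' k = α` to `⟨S f, u⟩`, where `S` is the mixed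
frame operator, is the integral of `crossTerm C g h f u α p`. -/
noncomputable def crossTerm (f u : L2 d) (α : EuclideanSpace ℝ (Fin d)) (p : P)
    (ξ : EuclideanSpace ℝ (Fin d)) : ℂ :=
  crossProduct f u α ξ * starRingEnd ℂ (dualTerm C g h α p ξ)

variable {C g h} {f u : L2 d} {K : Set (EuclideanSpace ℝ (Fin d))}

lemma crossProduct_translateL2_ae (f u : L2 d) (a α : EuclideanSpace ℝ (Fin d)) :
    crossProduct (translateL2 (-a) f) (translateL2 (-a) u) α =ᵐ[volume] fun ξ =>
      planeWave a α * crossProduct f u α ξ := by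
  filter_upwards [fourier_translateL2_ae (-a) f, (measurePreserving_sub_right volume
    α).quasiMeasurePreserving.ae (fourier_translateL2_ae (-a) u)] with ξ hf hu
  have h_wave : planeWave a ξ * planeWave (-a) (ξ - α) = planeWave a α := by
    rw [planeWave, planeWave, planeWave, ← Circle.coe_mul, ← AddChar.map_add_eq_mul, inner_neg_left,
      inner_sub_right]
    congr 2
    ring
  rw [crossProduct, crossProduct, hf, hu, neg_neg, map_mul, conj_planeWave, ← h_wave]
  ring

lemma aestronglyMeasurable_fourier_comp_sub (f : L2 d) (α : EuclideanSpace ℝ (Fin d)) :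
    AEStronglyMeasurable (fun ξ => starRingEnd ℂ ((𝓕 f : L2 d) (ξ - α))) :=
  RCLike.continuous_conj.comp_aestronglyMeasurable <|
    (Lp.aestronglyMeasurable _).comp_measurePreserving (measurePreserving_sub_right volume α)

lemma aestronglyMeasurable_crossProduct (f u : L2 d) (α : EuclideanSpace ℝ (Fin d)) :
    AEStronglyMeasurable (crossProduct f u α) :=
  (Lp.aestronglyMeasurable _).mul (aestronglyMeasurable_fourier_comp_sub u α)

lemma aestronglyMeasurable_crossTerm (f u : L2 d) (α : EuclideanSpace ℝ (Fin d)) (p : P) :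
    AEStronglyMeasurable (crossTerm C g h f u α p) :=
  (aestronglyMeasurable_crossProduct f u α).mul <|
    RCLike.continuous_conj.comp_aestronglyMeasurable <|
      ((aestronglyMeasurable_fourier_comp_sub (h p) α).const_mul _).mul (Lp.aestronglyMeasurable _)

lemma enorm_crossProduct_le (hf : IsTestVector K f) (hu : IsTestVector K u)
    (α : EuclideanSpace ℝ (Fin d)) : ∀ᵐ ξ, ‖crossProduct f u α ξ‖ₑ ≤
      (K ∩ (· - α) ⁻¹' K).indicator
        (fun _ => eLpNorm (𝓕 f : L2 d) ∞ volume * eLpNorm (𝓕 u : L2 d) ∞ volume) ξ := by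
  have h_shift := (measurePreserving_sub_right volume α).quasiMeasurePreserving
  filter_upwards [mem_bandSpace.1 hf.1, h_shift.ae (mem_bandSpace.1 hu.1),
    ae_le_eLpNormEssSup (f := (𝓕 f : L2 d)), h_shift.ae (ae_le_eLpNormEssSup (f := (𝓕 u : L2 d)))]
    with ξ hfK huK hf_le hu_le
  rw [crossProduct, enorm_mul, RCLike.enorm_conj]
  by_cases hξ : ξ ∈ K ∩ (· - α) ⁻¹' K
  · rw [Set.indicator_of_mem hξ]
    exact mul_le_mul' hf_le hu_le
  · rw [Set.indicator_of_notMem hξ, nonpos_iff_eq_zero, mul_eq_zero, enorm_eq_zero, enorm_eq_zero]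
    exact (not_and_or.1 hξ).imp hfK huK

lemma enorm_dualTerm_le (α : EuclideanSpace ℝ (Fin d)) (p : P) (ξ : EuclideanSpace ℝ (Fin d)) :
    ‖dualTerm C g h α p ξ‖ₑ ≤ fourierEnergy C h p (ξ - α) + fourierEnergy C g p ξ := by
  have h_amgm (x y : ℝ≥0∞) : x * y ≤ x ^ 2 + y ^ 2 := by
    rcases le_total x y with hxy | hxy
    · exact (mul_le_mul_left hxy y).trans (by rw [← sq]; exact le_add_self)
    · exact (mul_le_mul_right hxy x).trans (by rw [← sq]; exact le_self_add)
  rw [dualTerm, enorm_mul, enorm_mul, RCLike.enorm_conj, mul_assoc, fourierEnergy, fourierEnergy,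
    ← mul_add, ← ofReal_norm ((|(C p).det|⁻¹ : ℝ) : ℂ), Complex.norm_real,
    Real.norm_of_nonneg (inv_nonneg.2 (abs_nonneg _))]
  exact mul_le_mul_right (h_amgm _ _) _

lemma setLIntegral_overlap_comp_sub (α : EuclideanSpace ℝ (Fin d))
    (w : EuclideanSpace ℝ (Fin d) → ℝ≥0∞) :
    ∫⁻ ξ in K ∩ (· - α) ⁻¹' K, w (ξ - α) = ∫⁻ ξ in K ∩ (· + α) ⁻¹' K, w ξ := by
  rw [← (measurePreserving_sub_right volume α).setLIntegral_comp_preimage_emb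
    (MeasurableEquiv.subRight α).measurableEmbedding w, Set.preimage_inter, Set.preimage_preimage,
    Set.inter_comm]
  simp only [sub_add_cancel, Set.preimage_id']

lemma lintegral_enorm_crossTerm_le (hK : MeasurableSet K) (hf : IsTestVector K f)
    (hu : IsTestVector K u) (α : EuclideanSpace ℝ (Fin d)) (p : P) :
    ∫⁻ ξ, ‖crossTerm C g h f u α p ξ‖ₑ ≤
      eLpNorm (𝓕 f : L2 d) ∞ volume * eLpNorm (𝓕 u : L2 d) ∞ volume *
        ((∫⁻ ξ in K ∩ (· + α) ⁻¹' K, fourierEnergy C h p ξ) +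
          ∫⁻ ξ in K ∩ (· + -α) ⁻¹' K, fourierEnergy C g p ξ) := by
  set M := eLpNorm (𝓕 f : L2 d) ∞ volume * eLpNorm (𝓕 u : L2 d) ∞ volume
  have h_overlap : MeasurableSet (K ∩ (· - α) ⁻¹' K) :=
    hK.inter (measurable_sub_const α hK)
  have hM : M ≠ ∞ := ENNReal.mul_ne_top hf.2.2.ne hu.2.2.ne
  calc ∫⁻ ξ, ‖crossTerm C g h f u α p ξ‖ₑ
    _ ≤ ∫⁻ ξ in K ∩ (· - α) ⁻¹' K, M * (fourierEnergy C h p (ξ - α) + fourierEnergy C g p ξ) := by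
      rw [← lintegral_indicator h_overlap]
      refine lintegral_mono_ae ?_
      filter_upwards [enorm_crossProduct_le hf hu α] with ξ hξ
      rw [crossTerm, enorm_mul, RCLike.enorm_conj, Set.indicator_mul_left]
      exact mul_le_mul' hξ (enorm_dualTerm_le α p ξ)
    _ = _ := by
      rw [lintegral_const_mul' _ _ hM, lintegral_add_right' _
        (aemeasurable_fourierEnergy p).restrict, setLIntegral_overlap_comp_sub]
      simp only [sub_eq_add_neg]

lemma tsum_lintegral_enorm_crossTerm_ne_top (hK : MeasurableSet K) (hg : ShiftIntegrableOn C g K)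
    (hh : ShiftIntegrableOn C h K) (hf : IsTestVector K f) (hu : IsTestVector K u) :
    ∑' j : P × (Fin d → ℤ), ∫⁻ ξ, ‖crossTerm C g h f u (frequency C j) j.1 ξ‖ₑ ≠ ∞ := by
  have h_bound := ENNReal.tsum_le_tsum fun j : P × (Fin d → ℤ) =>
    lintegral_enorm_crossTerm_le (C := C) (g := g) (h := h) hK hf hu (frequency C j) j.1
  refine ne_top_of_le_ne_top ?_ h_bound
  rw [ENNReal.tsum_mul_left, ENNReal.tsum_add]
  have h_neg : ∑' j : P × (Fin d → ℤ), ∫⁻ ξ in K ∩ (· + -frequency C j) ⁻¹' K,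
      fourierEnergy C g j.1 ξ ≠ ∞ := by
    rw [← ((Equiv.refl P).prodCongr (Equiv.neg (Fin d → ℤ))).tsum_eq]
    simp only [Equiv.prodCongr_apply, Prod.map, Equiv.refl_apply, Equiv.neg_apply,
      frequency_neg_right, neg_neg]
    exact hg
  exact ENNReal.mul_ne_top (ENNReal.mul_ne_top hf.2.2.ne hu.2.2.ne)
    (ENNReal.add_ne_top.2 ⟨hh, h_neg⟩)

end CrossTerms

section Parseval

variable {d : ℕ} {P : Type*} {C : P → Matrix (Fin d) (Fin d) ℝ} {g h : P → L2 d}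
  {f u : L2 d} {K : Set (EuclideanSpace ℝ (Fin d))}

lemma IsTestVector.memLp_mul_conj (hf : IsTestVector K f) (v : L2 d) :
    MemLp (fun ξ => (𝓕 f : L2 d) ξ * starRingEnd ℂ ((𝓕 v : L2 d) ξ)) 2 :=
  (Lp.memLp (𝓕 v : L2 d)).star.mul hf.2

lemma IsTestVector.ae_mul_conj_eq_zero (hf : IsTestVector K f) (v : L2 d) :
    ∀ᵐ ξ, ξ ∉ K → (𝓕 f : L2 d) ξ * starRingEnd ℂ ((𝓕 v : L2 d) ξ) = 0 := by
  filter_upwards [mem_bandSpace.1 hf.1] with ξ hξ hξK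
  rw [hξ hξK, zero_mul]

lemma hasSum_inner_translationSystem (hC : ∀ p, IsUnit (C p).det) (hK : Bornology.IsBounded K)
    (hf : IsTestVector K f) (hu : IsTestVector K u) (p : P) :
    HasSum (fun k => inner ℂ (translationSystem C g (p, k)) f *
        inner ℂ u (translationSystem C h (p, k)))
      (∑' k, ∫ ξ, crossTerm C g h f u (frequency C (p, k)) p ξ) := by
  convert! hasSum_parseval_lattice (hC p) hK (hf.memLp_mul_conj (g p)) (hu.memLp_mul_conj (h p))
    (hf.ae_mul_conj_eq_zero (g p)) (hu.ae_mul_conj_eq_zero (h p)) using 2 with k k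
  · rw [translationSystem, translationSystem, inner_translateL2, ← inner_conj_symm,
      inner_translateL2]
  · funext k
    rw [← integral_const_mul]
    refine integral_congr_ae (ae_of_all _ fun ξ => ?_)
    simp only [crossTerm, crossProduct, dualTerm, frequency, map_mul, Complex.conj_conj,
      Complex.conj_ofReal]
    ring

lemma summable_norm_integral_crossTerm (hK : MeasurableSet K) (hg : ShiftIntegrableOn C g K)
    (hh : ShiftIntegrableOn C h K) (hf : IsTestVector K f) (hu : IsTestVector K u) :
    Summable fun j => ‖∫ ξ, crossTerm C g h f u (frequency C j) j.1 ξ‖ :=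
  tsum_enorm_ne_top_iff_summable_norm.1 <|
    ne_top_of_le_ne_top (tsum_lintegral_enorm_crossTerm_ne_top hK hg hh hf hu) <|
      ENNReal.tsum_le_tsum fun _ => enorm_integral_le_lintegral_enorm _

lemma hasSum_integral_crossTerm (hC : ∀ p, IsUnit (C p).det) (hK : IsCompact K)
    (hg : ShiftIntegrableOn C g K) (hh : ShiftIntegrableOn C h K)
    (hgB : IsBessel (translationSystem C g)) (hhB : IsBessel (translationSystem C h))
    (hf : IsTestVector K f) (hu : IsTestVector K u) :
    HasSum (fun j => ∫ ξ, crossTerm C g h f u (frequency C j) j.1 ξ)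
      (inner ℂ u (mixedFrameOperator hgB hhB f)) := by
  have h_sum :=
    (summable_norm_integral_crossTerm hK.measurableSet hg hh hf hu).of_norm.hasSum
  have h_parseval := (hasSum_inner_mixedFrameOperator hgB hhB u f).prod_fiberwise
    (hasSum_inner_translationSystem hC hK.isBounded hf hu)
  rwa [(h_sum.prod_fiberwise fun p =>
    (h_sum.summable.prod_factor p).hasSum).unique h_parseval] at h_sum

end Parseval

/-! ### Grouping the cross terms by frequency -/

lemma integrable_tsum_of_tsum_lintegral_enorm_ne_top {X ι : Type*} [MeasurableSpace X]
    {μ : Measure X} [Countable ι] {F : ι → X → ℂ} (hF : ∀ i, AEStronglyMeasurable (F i) μ)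
    (h_sum : ∑' i, ∫⁻ x, ‖F i x‖ₑ ∂μ ≠ ∞) : Integrable (fun x => ∑' i, F i x) μ := by
  refine ⟨(AEMeasurable.tsum fun i => (hF i).aemeasurable).aestronglyMeasurable, ?_⟩
  refine (lintegral_mono fun x => enorm_tsum_le_tsum_enorm).trans_lt ?_
  rw [lintegral_tsum fun i => (hF i).enorm]
  exact h_sum.lt_top

section FrequencyFiber

variable {d : ℕ} {P : Type*} {C : P → Matrix (Fin d) (Fin d) ℝ} {g h : P → L2 d}
  {f u : L2 d} {K : Set (EuclideanSpace ℝ (Fin d))} {α : EuclideanSpace ℝ (Fin d)}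

lemma latticePoint_dualMatrix_eq_iff {D : Matrix (Fin d) (Fin d) ℝ} (hD : IsUnit D.det)
    {k : Fin d → ℤ} :
    latticePoint (dualMatrix D) k = α ↔ Dᵀ *ᵥ α.ofLp = fun i => (k i : ℝ) := by
  have hDT : IsUnit Dᵀ.det := D.isUnit_det_transpose hD
  constructor
  · rintro rfl
    rw [latticePoint, dualMatrix, Matrix.mulVec_mulVec, Matrix.mul_nonsing_inv _ hDT,
      Matrix.one_mulVec]
  · intro h_eq
    rw [latticePoint, dualMatrix, ← h_eq, Matrix.mulVec_mulVec, Matrix.nonsing_inv_mul _ hDT,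
      Matrix.one_mulVec]

lemma mem_indexSet_iff (hC : ∀ p, IsUnit (C p).det) {p : P} :
    p ∈ indexSet C α ↔ ∃ k, frequency C (p, k) = α :=
  exists_congr fun _ => (latticePoint_dualMatrix_eq_iff (hC p)).symm

lemma frequency_injective_right (hC : ∀ p, IsUnit (C p).det) (p : P) :
    Function.Injective fun k => frequency C (p, k) := by
  intro k l hkl
  have h_cast := ((latticePoint_dualMatrix_eq_iff (hC p)).1 hkl).symm.trans
    ((latticePoint_dualMatrix_eq_iff (hC p)).1 rfl)
  exact funext fun i => Int.cast_injective (congrFun h_cast i)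

/-- The cross terms with frequency `α` are indexed by `P_α`, since the frequency `C_p' k`
determines `k` once `p` is fixed. -/
noncomputable def frequencyFiberEquiv (hC : ∀ p, IsUnit (C p).det)
    (α : EuclideanSpace ℝ (Fin d)) : frequency C ⁻¹' {α} ≃ indexSet C α :=
  .ofBijective (fun j => ⟨j.1.1, (mem_indexSet_iff hC).2 ⟨j.1.2, j.2⟩⟩) <| by
    constructor
    · rintro ⟨⟨p, k⟩, hk⟩ ⟨⟨q, l⟩, hl⟩ h_eq
      obtain rfl : p = q := congrArg Subtype.val h_eq
      obtain rfl : k = l := frequency_injective_right hC p (hk.trans hl.symm)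
      rfl
    · rintro ⟨p, hp⟩
      obtain ⟨k, hk⟩ := (mem_indexSet_iff hC).1 hp
      exact ⟨⟨(p, k), hk⟩, rfl⟩

variable (C g h) in
/-- The sum of the series in the duality condition for the frequency `α`. -/
noncomputable def dualSum (α ξ : EuclideanSpace ℝ (Fin d)) : ℂ :=
  ∑' p : indexSet C α, dualTerm C g h α p ξ

variable (C g h) in
/-- The sum of all contributions of the frequency `α` to `⟨S f, u⟩`, where `S` is the mixed frame
operator. -/
noncomputable def frequencyCoeff (f u : L2 d) (α : EuclideanSpace ℝ (Fin d)) : ℂ :=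
  ∫ ξ, crossProduct f u α ξ * starRingEnd ℂ (dualSum C g h α ξ)

lemma crossProduct_mul_conj_dualSum (f u : L2 d) (α ξ : EuclideanSpace ℝ (Fin d)) :
    crossProduct f u α ξ * starRingEnd ℂ (dualSum C g h α ξ) =
      ∑' p : indexSet C α, crossTerm C g h f u α p ξ := by
  simp_rw [crossTerm, tsum_mul_left, dualSum, Complex.conj_tsum]

lemma tsum_indexSet_lintegral_enorm_crossTerm_ne_top (hC : ∀ p, IsUnit (C p).det)
    (hK : MeasurableSet K) (hg : ShiftIntegrableOn C g K) (hh : ShiftIntegrableOn C h K)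
    (hf : IsTestVector K f) (hu : IsTestVector K u) (α : EuclideanSpace ℝ (Fin d)) :
    ∑' p : indexSet C α, ∫⁻ ξ, ‖crossTerm C g h f u α p ξ‖ₑ ≠ ∞ := by
  refine ne_top_of_le_ne_top (tsum_lintegral_enorm_crossTerm_ne_top hK hg hh hf hu) ?_
  rw [← (frequencyFiberEquiv hC α).tsum_eq]
  refine le_trans (ENNReal.tsum_le_tsum fun j => ?_)
    (ENNReal.tsum_comp_le_tsum_of_injective Subtype.val_injective _)
  rw [show frequency C j.1 = α from j.2]
  rfl

variable [Countable P]

lemma integrable_crossProduct_mul_conj_dualSum (hC : ∀ p, IsUnit (C p).det)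
    (hK : MeasurableSet K) (hg : ShiftIntegrableOn C g K) (hh : ShiftIntegrableOn C h K)
    (hf : IsTestVector K f) (hu : IsTestVector K u) (α : EuclideanSpace ℝ (Fin d)) :
    Integrable fun ξ => crossProduct f u α ξ * starRingEnd ℂ (dualSum C g h α ξ) := by
  simp_rw [crossProduct_mul_conj_dualSum]
  exact integrable_tsum_of_tsum_lintegral_enorm_ne_top
    (fun p : indexSet C α => aestronglyMeasurable_crossTerm f u α p.1)
    (tsum_indexSet_lintegral_enorm_crossTerm_ne_top hC hK hg hh hf hu α)

lemma tsum_frequency_fiber_integral_crossTerm (hC : ∀ p, IsUnit (C p).det)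
    (hK : MeasurableSet K) (hg : ShiftIntegrableOn C g K) (hh : ShiftIntegrableOn C h K)
    (hf : IsTestVector K f) (hu : IsTestVector K u) (α : EuclideanSpace ℝ (Fin d)) :
    ∑' j : frequency C ⁻¹' {α}, ∫ ξ, crossTerm C g h f u (frequency C j) j.1.1 ξ =
      frequencyCoeff C g h f u α := by
  simp_rw [frequencyCoeff, crossProduct_mul_conj_dualSum]
  rw [integral_tsum (fun p : indexSet C α => aestronglyMeasurable_crossTerm f u α p.1)
    (tsum_indexSet_lintegral_enorm_crossTerm_ne_top hC hK hg hh hf hu α),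
    ← (frequencyFiberEquiv hC α).tsum_eq]
  refine tsum_congr fun j => ?_
  rw [show frequency C j.1 = α from j.2]
  rfl

end FrequencyFiber

/-! ### The frequency coefficients determine the mixed frame operator -/

section FrequencyCoeff

variable {d : ℕ} {P : Type*} {C : P → Matrix (Fin d) (Fin d) ℝ} {g h : P → L2 d}
  {f u : L2 d} {E K : Set (EuclideanSpace ℝ (Fin d))}

lemma integral_crossProduct_zero (f u : L2 d) : ∫ ξ, crossProduct f u 0 ξ = inner ℂ u f := by
  simp only [crossProduct, sub_zero, inner_eq_integral_fourier]

lemma inner_translateL2_translateL2 (a : EuclideanSpace ℝ (Fin d)) (u f : L2 d) :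
    inner ℂ (translateL2 a u) (translateL2 a f) = inner ℂ u f :=
  (Lp.compMeasurePreservingₗᵢ ℂ _ (measurePreserving_sub_right volume a)).inner_map_map u f

lemma integral_crossTerm_translateL2 (f u : L2 d) (a α : EuclideanSpace ℝ (Fin d)) (p : P) :
    ∫ ξ, crossTerm C g h (translateL2 (-a) f) (translateL2 (-a) u) α p ξ =
      planeWave a α * ∫ ξ, crossTerm C g h f u α p ξ := by
  rw [← integral_const_mul]
  refine integral_congr_ae ?_
  filter_upwards [crossProduct_translateL2_ae f u a α] with ξ hξ
  rw [crossTerm, crossTerm, hξ, mul_assoc]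

open Classical in
lemma frequencyCoeff_eq_ite_of_ae_dualSum
    (h_dual : ∀ α, ∀ᵐ ξ, ξ ∈ E → dualSum C g h α ξ = if α = 0 then 1 else 0)
    (hfE : f ∈ bandSpace E) (α : EuclideanSpace ℝ (Fin d)) :
    frequencyCoeff C g h f u α = if α = 0 then inner ℂ u f else 0 := by
  have h_congr : frequencyCoeff C g h f u α =
      ∫ ξ, crossProduct f u α ξ * starRingEnd ℂ (if α = 0 then 1 else 0) := by
    refine integral_congr_ae ?_
    filter_upwards [h_dual α, mem_bandSpace.1 hfE] with ξ hξ hfξ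
    by_cases hξE : ξ ∈ E
    · rw [hξ hξE]
    · simp only [crossProduct, hfξ hξE, zero_mul]
  rw [h_congr]
  split_ifs with hα
  · simp only [hα, map_one, mul_one, integral_crossProduct_zero]
  · simp only [map_zero, mul_zero, integral_zero]

variable [Countable P]

lemma hasSum_frequencyCoeff (hC : ∀ p, IsUnit (C p).det) (hK : IsCompact K)
    (hg : ShiftIntegrableOn C g K) (hh : ShiftIntegrableOn C h K)
    (hgB : IsBessel (translationSystem C g)) (hhB : IsBessel (translationSystem C h))
    (hf : IsTestVector K f) (hu : IsTestVector K u) :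
    HasSum (frequencyCoeff C g h f u) (inner ℂ u (mixedFrameOperator hgB hhB f)) :=
  ((hasSum_integral_crossTerm hC hK hg hh hgB hhB hf hu).tsum_fiberwise (frequency C)).congr_fun
    fun α => (tsum_frequency_fiber_integral_crossTerm hC hK.measurableSet hg hh hf hu α).symm

open Classical in
lemma frequencyCoeff_eq_ite (hC : ∀ p, IsUnit (C p).det) (hK : IsCompact K)
    (hg : ShiftIntegrableOn C g K) (hh : ShiftIntegrableOn C h K)
    {hgB : IsBessel (translationSystem C g)} {hhB : IsBessel (translationSystem C h)}
    (hS : ∀ v ∈ bandSpace E, mixedFrameOperator hgB hhB v = v) (hfE : f ∈ bandSpace E)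
    (hf : IsTestVector K f) (hu : IsTestVector K u) (α : EuclideanSpace ℝ (Fin d)) :
    frequencyCoeff C g h f u α = if α = 0 then inner ℂ u f else 0 := by
  rw [← tsum_frequency_fiber_integral_crossTerm hC hK.measurableSet hg hh hf hu]
  refine tsum_frequency_fiber_eq (summable_norm_integral_crossTerm hK.measurableSet hg hh hf hu)
    (fun a => ?_) α
  have h_sum := hasSum_integral_crossTerm hC hK hg hh hgB hhB (hf.translateL2 (-a))
    (hu.translateL2 (-a))
  rw [hS _ (translateL2_mem_bandSpace (-a) hfE), inner_translateL2_translateL2] at h_sum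
  exact h_sum.congr_fun fun j => (integral_crossTerm_translateL2 f u a _ _).symm

end FrequencyCoeff

section Indicator

variable {d : ℕ} {A B : Set (EuclideanSpace ℝ (Fin d))}
  (hA : MeasurableSet A) (hA_fin : volume A ≠ ∞)
  (hB : MeasurableSet B) (hB_fin : volume B ≠ ∞) (α : EuclideanSpace ℝ (Fin d))

lemma crossProduct_fourierIndicator_mul_ae (w : EuclideanSpace ℝ (Fin d) → ℂ) :
    (fun ξ => crossProduct (fourierIndicator hA hA_fin) (fourierIndicator hB hB_fin) α ξ * w ξ)
      =ᵐ[volume] (A ∩ (· - α) ⁻¹' B).indicator w := by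
  filter_upwards [fourier_fourierIndicator_ae hA hA_fin, (measurePreserving_sub_right volume
    α).quasiMeasurePreserving.ae (fourier_fourierIndicator_ae hB hB_fin)] with ξ hξA hξB
  rw [crossProduct, hξA, hξB]
  by_cases h_memA : ξ ∈ A <;> by_cases h_memB : ξ - α ∈ B <;> simp [h_memA, h_memB]

lemma integral_crossProduct_fourierIndicator_mul (w : EuclideanSpace ℝ (Fin d) → ℂ) :
    ∫ ξ, crossProduct (fourierIndicator hA hA_fin) (fourierIndicator hB hB_fin) α ξ * w ξ =
      ∫ ξ in A ∩ (· - α) ⁻¹' B, w ξ := by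
  rw [integral_congr_ae (crossProduct_fourierIndicator_mul_ae hA hA_fin hB hB_fin α w),
    integral_indicator (hA.inter (measurable_sub_const α hB))]

end Indicator

section DualSumIntegral

variable {d : ℕ} {P : Type*} [Countable P] {C : P → Matrix (Fin d) (Fin d) ℝ} {g h : P → L2 d}
  {A B E K : Set (EuclideanSpace ℝ (Fin d))} (α : EuclideanSpace ℝ (Fin d))

lemma integrableOn_conj_dualSum (hC : ∀ p, IsUnit (C p).det)
    (hK : MeasurableSet K) (hK_fin : volume K ≠ ∞) (hg : ShiftIntegrableOn C g K)
    (hh : ShiftIntegrableOn C h K) :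
    IntegrableOn (fun ξ => starRingEnd ℂ (dualSum C g h α ξ)) (K ∩ (· - α) ⁻¹' K) := by
  have h_test := isTestVector_fourierIndicator hK hK_fin
  rw [← integrable_indicator_iff (hK.inter (measurable_sub_const α hK)),
    ← integrable_congr (crossProduct_fourierIndicator_mul_ae hK hK_fin hK hK_fin α _)]
  exact integrable_crossProduct_mul_conj_dualSum hC hK hg hh h_test h_test α

open Classical in
lemma setIntegral_conj_dualSum_eq (hC : ∀ p, IsUnit (C p).det) (hB : IsCompact B)
    (hg : ShiftIntegrableOn C g B) (hh : ShiftIntegrableOn C h B)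
    {hgB : IsBessel (translationSystem C g)} {hhB : IsBessel (translationSystem C h)}
    (hS : ∀ v ∈ bandSpace E, mixedFrameOperator hgB hhB v = v)
    (hA : MeasurableSet A) (hAE : A ⊆ E) (hAB : A ⊆ B) (hAB_shift : A ⊆ (· - α) ⁻¹' B) :
    ∫ ξ in A, starRingEnd ℂ (dualSum C g h α ξ) = ∫ _ in A, if α = 0 then 1 else 0 := by
  have hB_fin : volume B ≠ ∞ := hB.measure_lt_top.ne
  have hA_fin := measure_ne_top_of_subset hAB hB_fin
  have hA_test := isTestVector_fourierIndicator hA hA_fin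
  have hB_test := isTestVector_fourierIndicator hB.measurableSet hB_fin
  have h_coeff := frequencyCoeff_eq_ite hC hB hg hh hS (bandSpace_mono hAE hA_test.1)
    (hA_test.mono hAB) hB_test α
  rw [frequencyCoeff, integral_crossProduct_fourierIndicator_mul,
    Set.inter_eq_left.2 hAB_shift] at h_coeff
  rw [h_coeff]
  split_ifs with hα
  · have h_one := integral_crossProduct_fourierIndicator_mul hA hA_fin hB.measurableSet
      hB_fin α 1
    rw [Set.inter_eq_left.2 hAB_shift] at h_one
    simpa only [Pi.one_apply, mul_one, hα, integral_crossProduct_zero] using h_one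
  · rw [integral_zero]

end DualSumIntegral

/-! ### The duality conditions -/

section Characterization

variable {d : ℕ} {P : Type*} {C : P → Matrix (Fin d) (Fin d) ℝ} {g h : P → L2 d}
  {E : Set (EuclideanSpace ℝ (Fin d))} {K : ℕ → Set (EuclideanSpace ℝ (Fin d))}

lemma indexSet_zero : indexSet C 0 = Set.univ :=
  Set.eq_univ_of_forall fun _ => ⟨0, by
    funext i
    simp⟩

lemma mem_dualLatticeUnion_of_mem_indexSet (hC : ∀ p, IsUnit (C p).det)
    {α : EuclideanSpace ℝ (Fin d)} {p : P} (hp : p ∈ indexSet C α) : α ∈ dualLatticeUnion C :=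
  Set.mem_iUnion.2 ⟨p, (mem_indexSet_iff hC).1 hp⟩

lemma aecover_preimage_sub_right (hK : AECover volume Filter.atTop K)
    (α : EuclideanSpace ℝ (Fin d)) :
    AECover volume Filter.atTop fun n => (· - α) ⁻¹' K n :=
  ⟨(measurePreserving_sub_right volume α).quasiMeasurePreserving.ae hK.ae_eventually_mem,
    fun n => measurable_sub_const α (hK.measurableSet n)⟩

variable [Countable P]

open Classical in
lemma ae_dualSum_eq_ite (hC : ∀ p, IsUnit (C p).det) (hE : MeasurableSet E)
    (hK : AECover volume Filter.atTop K) (hK_compact : ∀ n, IsCompact (K n))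
    (hg : ∀ n, ShiftIntegrableOn C g (K n)) (hh : ∀ n, ShiftIntegrableOn C h (K n))
    {hgB : IsBessel (translationSystem C g)} {hhB : IsBessel (translationSystem C h)}
    (hS : ∀ v ∈ bandSpace E, mixedFrameOperator hgB hhB v = v) (α : EuclideanSpace ℝ (Fin d)) :
    ∀ᵐ ξ, ξ ∈ E → dualSum C g h α ξ = if α = 0 then 1 else 0 := by
  have hK_fin (n : ℕ) : volume (K n) ≠ ∞ := (hK_compact n).measure_lt_top.ne
  have h_dualSum (n : ℕ) := integrableOn_conj_dualSum α hC (hK.measurableSet n) (hK_fin n) (hg n)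
    (hh n)
  have h_const (n : ℕ) : IntegrableOn (fun _ => if α = 0 then (1 : ℂ) else 0)
      (K n ∩ (· - α) ⁻¹' K n) :=
    integrableOn_const (measure_ne_top_of_subset Set.inter_subset_left (hK_fin n))
  have h_vanish := ae_eq_zero_of_forall_setIntegral_eq_zero_of_aecover hE
    (hK.inter (aecover_preimage_sub_right hK α))
    (fun n => ((h_dualSum n).sub (h_const n)).mono_set Set.inter_subset_right)
    fun n A hA hA_sub => by
      obtain ⟨hAE, hAK⟩ := Set.subset_inter_iff.1 hA_sub
      refine (integral_sub ((h_dualSum n).mono_set hAK) ((h_const n).mono_set hAK)).trans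
        (sub_eq_zero.2 ?_)
      exact setIntegral_conj_dualSum_eq α hC (hK_compact n) (hg n) (hh n) hS hA hAE
        (hAK.trans Set.inter_subset_left) (hAK.trans Set.inter_subset_right)
  filter_upwards [h_vanish] with ξ hξ hξE
  have h_conj : starRingEnd ℂ (dualSum C g h α ξ) = if α = 0 then 1 else 0 :=
    sub_eq_zero.1 (hξ hξE)
  rw [← Complex.conj_conj (dualSum C g h α ξ), h_conj, apply_ite (starRingEnd ℂ), map_one,
    map_zero]

open Classical in
lemma mixedFrameOperator_eq_self_of_ae_dualSum (hC : ∀ p, IsUnit (C p).det) (hE : MeasurableSet E)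
    (hK : AECover volume Filter.atTop K) (hK_mono : Monotone K)
    (hK_compact : ∀ n, IsCompact (K n))
    (hg : ∀ n, ShiftIntegrableOn C g (K n)) (hh : ∀ n, ShiftIntegrableOn C h (K n))
    (hgB : IsBessel (translationSystem C g)) (hhB : IsBessel (translationSystem C h))
    (h_dual : ∀ α, ∀ᵐ ξ, ξ ∈ E → dualSum C g h α ξ = if α = 0 then 1 else 0) {v : L2 d}
    (hv : v ∈ bandSpace E) : mixedFrameOperator hgB hhB v = v := by
  refine sub_eq_zero.1 (eq_zero_on_bandSpace_of_forall_inner_eq_zero hE hK hK_mono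
    (fun n => (hK_compact n).measure_lt_top.ne) (mixedFrameOperator hgB hhB - 1)
    (fun n f u hfE hf hu => ?_) hv)
  have h_sum := hasSum_frequencyCoeff hC (hK_compact n) (hg n) (hh n) hgB hhB hf hu
  have h_coeff := funext (frequencyCoeff_eq_ite_of_ae_dualSum (u := u) h_dual hfE)
  rw [h_coeff] at h_sum
  rw [sub_apply, one_apply_eq_self, inner_sub_right, sub_eq_zero]
  exact h_sum.unique (hasSum_ite_eq 0 _)

lemma ae_tsum_fourierEnergy_ne_top (hK : AECover volume Filter.atTop K)
    (hg : ∀ n, ShiftIntegrableOn C g (K n)) : ∀ᵐ ξ, ∑' p, fourierEnergy C g p ξ ≠ ∞ := by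
  have h_piece (n : ℕ) : ∀ᵐ ξ, ξ ∈ K n → ∑' p, fourierEnergy C g p ξ < ∞ := by
    rw [← ae_restrict_iff' (hK.measurableSet n)]
    have h_meas (p : P) := (aemeasurable_fourierEnergy (C := C) (g := g) p).restrict (s := K n)
    refine ae_lt_top' (.tsum h_meas) ?_
    rw [lintegral_tsum h_meas]
    refine ne_top_of_le_ne_top (hg n) ?_
    have h_zero := ENNReal.tsum_comp_le_tsum_of_injective (Prod.mk_left_injective (0 : Fin d → ℤ))
      fun j : P × (Fin d → ℤ) =>
        ∫⁻ ξ in K n ∩ (· + frequency C j) ⁻¹' K n, fourierEnergy C g j.1 ξ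
    simpa only [frequency_zero_right, add_zero, Set.preimage_id', Set.inter_self] using h_zero
  filter_upwards [ae_all_iff.2 h_piece, hK.ae_eventually_mem] with ξ hξ h_mem
  obtain ⟨n, hn⟩ := h_mem.exists
  exact (hξ n hn).ne

lemma ae_summable_dualTerm (hK : AECover volume Filter.atTop K)
    (hg : ∀ n, ShiftIntegrableOn C g (K n)) (hh : ∀ n, ShiftIntegrableOn C h (K n))
    (α : EuclideanSpace ℝ (Fin d)) : ∀ᵐ ξ, Summable fun p => dualTerm C g h α p ξ := by
  filter_upwards [ae_tsum_fourierEnergy_ne_top hK hg, (measurePreserving_sub_right volume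
    α).quasiMeasurePreserving.ae (ae_tsum_fourierEnergy_ne_top hK hh)] with ξ hgξ hhξ
  refine (tsum_enorm_ne_top_iff_summable_norm.1 <| ne_top_of_le_ne_top ?_ <|
    ENNReal.tsum_le_tsum fun p => enorm_dualTerm_le α p ξ).of_norm
  rw [ENNReal.tsum_add]
  exact ENNReal.add_ne_top.2 ⟨hhξ, hgξ⟩

lemma ae_dualSum_eq_iff_ae_hasSum (hK : AECover volume Filter.atTop K)
    (hg : ∀ n, ShiftIntegrableOn C g (K n)) (hh : ∀ n, ShiftIntegrableOn C h (K n))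
    (α : EuclideanSpace ℝ (Fin d)) (c : ℂ) :
    (∀ᵐ ξ, ξ ∈ E → dualSum C g h α ξ = c) ↔
      ∀ᵐ ξ, ξ ∈ E → HasSum (fun p : indexSet C α => dualTerm C g h α p ξ) c := by
  refine Filter.eventually_congr ?_
  filter_upwards [ae_summable_dualTerm hK hg hh α] with ξ hξ
  exact imp_congr_right fun _ => (hξ.subtype (indexSet C α)).hasSum_iff.symm

open Classical in
lemma ae_dualSum_eq_ite_iff (hC : ∀ p, IsUnit (C p).det) (hK : AECover volume Filter.atTop K)
    (hg : ∀ n, ShiftIntegrableOn C g (K n)) (hh : ∀ n, ShiftIntegrableOn C h (K n)) :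
    (∀ α, ∀ᵐ ξ, ξ ∈ E → dualSum C g h α ξ = if α = 0 then 1 else 0) ↔
      (∀ᵐ ξ, ξ ∈ E → HasSum (fun p => dualTerm C g h 0 p ξ) 1) ∧
      ∀ α ∈ dualLatticeUnion C \ {0}, ∀ᵐ ξ, ξ ∈ E →
        HasSum (fun p : indexSet C α => dualTerm C g h α p ξ) 0 := by
  have h_zero (ξ : EuclideanSpace ℝ (Fin d)) :
      HasSum (fun p : indexSet C 0 => dualTerm C g h 0 p ξ) 1 ↔
        HasSum (fun p => dualTerm C g h 0 p ξ) 1 := by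
    rw [indexSet_zero]
    exact hasSum_subtype_iff_of_support_subset (f := fun p => dualTerm C g h 0 p ξ)
      (Set.subset_univ _)
  simp_rw [ae_dualSum_eq_iff_ae_hasSum hK hg hh, ← h_zero]
  refine ⟨fun h_dual => ⟨by simpa only [if_pos] using h_dual 0, fun α hα => ?_⟩, ?_⟩
  · have hα_ne : α ≠ 0 := hα.2
    simpa only [if_neg hα_ne] using h_dual α
  rintro ⟨h_diag, h_off⟩ α
  by_cases hα : α = 0
  · subst hα
    simpa only [if_pos] using h_diag
  rw [if_neg hα]
  by_cases h_mem : α ∈ dualLatticeUnion C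
  · exact h_off α ⟨h_mem, hα⟩
  · have : IsEmpty (indexSet C α) :=
      ⟨fun p => h_mem (mem_dualLatticeUnion_of_mem_indexSet hC p.2)⟩
    exact ae_of_all _ fun _ _ => hasSum_empty

end Characterization

end TranslationFrames

theorem mainTheorem11 {d : ℕ} {P : Type*} [Countable P]
    (C : P → Matrix (Fin d) (Fin d) ℝ) (hC : ∀ p, IsUnit (C p).det)
    (g h : P → TranslationFrames.L2 d)
    (hgB : TranslationFrames.IsBessel (TranslationFrames.translationSystem C g))
    (hhB : TranslationFrames.IsBessel (TranslationFrames.translationSystem C h))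
    (hgL : TranslationFrames.LocallyIntegrableSystem C g)
    (hhL : TranslationFrames.LocallyIntegrableSystem C h)
    (E : Set (EuclideanSpace ℝ (Fin d))) (hE : MeasurableSet E) :
    TranslationFrames.IsSubspaceDual (TranslationFrames.bandSpace E)
        (TranslationFrames.translationSystem C g) (TranslationFrames.translationSystem C h) ↔
      (∀ᵐ ξ, ξ ∈ E →
        HasSum (fun p : P => ((|(C p).det|⁻¹ : ℝ) : ℂ) *
          starRingEnd ℂ ((𝓕 (h p) : TranslationFrames.L2 d) ξ) *
            (𝓕 (g p) : TranslationFrames.L2 d) ξ) 1) ∧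
      ∀ α ∈ TranslationFrames.dualLatticeUnion C \ {0}, ∀ᵐ ξ, ξ ∈ E →
        HasSum (fun p : TranslationFrames.indexSet C α => ((|(C p).det|⁻¹ : ℝ) : ℂ) *
          starRingEnd ℂ ((𝓕 (h p) : TranslationFrames.L2 d) (ξ - α)) *
            (𝓕 (g p) : TranslationFrames.L2 d) ξ) 0 := by
  obtain ⟨K, hK, hK_mono, hK_compact, h0⟩ := TranslationFrames.exists_aecover_isCompact d
  have hg := fun n =>
    TranslationFrames.shiftIntegrableOn_of_isCompact hgB hgL (hK_compact n) (h0 n)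
  have hh := fun n =>
    TranslationFrames.shiftIntegrableOn_of_isCompact hhB hhL (hK_compact n) (h0 n)
  have h_series := TranslationFrames.ae_dualSum_eq_ite_iff (E := E) hC hK hg hh
  simp only [TranslationFrames.dualTerm, sub_zero] at h_series
  rw [TranslationFrames.isSubspaceDual_iff_mixedFrameOperator hgB hhB, ← h_series]
  constructor
  · intro hS
    exact TranslationFrames.ae_dualSum_eq_ite hC hE hK hK_compact hg hh hS
  · intro h_dual v hv
    exact TranslationFrames.mixedFrameOperator_eq_self_of_ae_dualSum hC hE hK hK_mono hK_compact
      hg hh hgB hhB h_dual hv
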